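/- Let $n\ge 1$. The $4n$-gon has vertex set $\mathbb Z/4n$ in cyclic order, and its edges are all unordered pairs of distinct vertices (sides and diagonals); two edges cross if their four endpoints are distinct and alternate in the cyclic order. A $2$-triangulation of the $4n$-gon is an inclusion-maximal set of edges with no three pairwise crossing edges; it is $n$-periodic if it is invariant under the rotation $i\mapsto i+n$ (rotation by $\pi/2$). For an edge $e$ let $\tilde e$ be the set consisting of $e$ and its copies under this rotation. An edge $[i,j]$ of the $4n$-gon is $2$-relevant if its length, i.e. the cyclic distance between $i$ and $j$, is greater than $2$. Two distinct $n$-periodic $2$-triangulations $T,T'$ are related by a flip if $T'=(T\setminus\tilde e)\cup\tilde f$ for some $2$-relevant $e\in T$ and some edge $f\notin T$. Let $G^n_{4n,2}$ be the graph whose vertices are the $n$-periodic $2$-triangulations of the $4n$-gon and whose edges are the pairs related by a flip. Let $\mathcal C_n$ be the half-cylinder with $n$ marked points on its boundary circle. Its universal cover has vertex set $\mathbb Z$; the edges of the cover are the unordered pairs $[u,v]$ of distinct integers, of length $|u-v|$, and two of them cross if their endpoints alternate. The edges of $\mathcal C_n$ are the classes of such pairs under simultaneous translation of both endpoints by multiples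 of $n$. A $2$-triangulation of $\mathcal C_n$ is an inclusion-maximal set $T$ of edges of $\mathcal C_n$ such that its lift (the set of all edges of the cover whose class is in $T$) contains no three pairwise crossing edges. Two distinct $2$-triangulations $T,T'$ of $\mathcal C_n$ are related by a flip if $T'=(T\setminus\{e\})\cup\{f\}$ for some $e\in T$ of length $\ell$ with $2<\ell\le 2n$ and some edge $f\notin T$. **Theorem.** The graph $G^n_{4n,2}$ is regular of degree $2(n-1)$. Equivalently, the flip graph of $2$-triangulations of $\mathcal C_n$ is regular of degree $2(n-1)$: reducing the endpoints of the edges in the lift of $T$ modulo $4n$ defines an isomorphism from the flip graph of $2$-triangulations of $\mathcal C_n$ onto $G^n_{4n,2}$. -/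

import Mathlib

namespace Multitriangulation

/-- An edge on the vertex set `V`: an unordered pair of distinct vertices.  For `V = ZMod N` these
are the edges (sides and diagonals) of the convex `N`-gon with vertices labelled in cyclic order;
for `V = ℤ` they are the edges of the infinite polygon with vertex set `ℤ`, the universal cover
of the half-cylinder. -/
def Edge (V : Type*) : Type _ := {e : Sym2 V // ¬ e.IsDiag}

section Crossings

variable {V : Type*} [CircularOrder V]

/-- Two edges cross (intersect in their interiors) when their endpoints strictly alternate in the
cyclic order of the vertices. -/
def Edge.Crosses (e f : Edge V) : Prop :=
  ∃ a b c d : V, e.1 = s(a, b) ∧ f.1 = s(c, d) ∧ sbtw a c b ∧ sbtw b d a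

/-- A `k`-crossing: a set of `k` pairwise crossing edges. -/
def IsCrossing (k : ℕ) (F : Finset (Edge V)) : Prop :=
  F.card = k ∧ (F : Set (Edge V)).Pairwise Edge.Crosses

/-- A set of edges is `k`-crossing-free when it contains no `k`-crossing. -/
def CrossingFree (k : ℕ) (T : Set (Edge V)) : Prop :=
  ∀ F : Finset (Edge V), (F : Set (Edge V)) ⊆ T → ¬ IsCrossing k F

end Crossings

section Translations

variable {V : Type*} [AddCommGroup V]

/-- The edge `e + c = [u + c, v + c]` for `e = [u, v]`. -/
def Edge.shift (c : V) (e : Edge V) : Edge V :=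
  ⟨e.1.map (· + c), fun h => e.2 ((Sym2.isDiag_map (add_left_injective c)).1 h)⟩

/-- All the translations `e + ℓ c`, `ℓ ∈ ℤ`, of an edge `e`. -/
def Edge.orbit (c : V) (e : Edge V) : Set (Edge V) :=
  {f | ∃ ℓ : ℤ, f = e.shift (ℓ • c)}

theorem Edge.shift_zero (e : Edge V) : e.shift 0 = e := by
  apply Subtype.ext
  simp [Edge.shift]

theorem Edge.shift_shift (c d : V) (e : Edge V) : (e.shift c).shift d = e.shift (c + d) := by
  apply Subtype.ext
  simp [Edge.shift, Sym2.map_map, add_assoc]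

end Translations

section Polygon

/-- The length of an edge of the `N`-gon: the number of sides on the shorter way around between
its endpoints. -/
def polyLength {N : ℕ} (e : Edge (ZMod N)) : ℕ :=
  Sym2.lift ⟨fun u v => (v - u).valMinAbs.natAbs, fun u v => by
    change (v - u).valMinAbs.natAbs = (u - v).valMinAbs.natAbs
    rw [← neg_sub, ZMod.natAbs_valMinAbs_neg]⟩ e.1

/-- A `k`-triangulation of the `N`-gon: an inclusion-maximal `(k+1)`-crossing-free set of edges. -/
def IsPolyTriangulation (N k : ℕ) (T : Set (Edge (ZMod N))) : Prop :=
  Maximal (CrossingFree (k + 1)) T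

/-- The `n`-periodic `k`-triangulations of the `N`-gon: those invariant under the rotation that
moves each vertex `n` steps further. -/
def PeriodicTriangulation (N n k : ℕ) : Type :=
  {T : Set (Edge (ZMod N)) //
    IsPolyTriangulation N k T ∧ ∀ e, e.shift (n : ZMod N) ∈ T ↔ e ∈ T}

/-- `T'` is obtained from `T` by a flip: a `k`-relevant edge of `T` is replaced, together with its
rotational copies, by an edge not in `T` together with its rotational copies. -/
def IsPolyFlip {N n k : ℕ} (T T' : PeriodicTriangulation N n k) : Prop :=
  ∃ e ∈ T.1, k < polyLength e ∧ ∃ f ∉ T.1,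
    T'.1 = (T.1 \ e.orbit (n : ZMod N)) ∪ f.orbit (n : ZMod N)

/-- The flip graph of `n`-periodic `k`-triangulations of the `N`-gon. -/
def periodicFlipGraph (N n k : ℕ) : SimpleGraph (PeriodicTriangulation N n k) :=
  SimpleGraph.fromRel IsPolyFlip

end Polygon

section HalfCylinder

/-- Two edges of the universal cover are identified when they differ by a translation by a
multiple of `n`. -/
def translationSetoid (n : ℕ) : Setoid (Edge ℤ) where
  r e f := f ∈ e.orbit (n : ℤ)
  iseqv :=
    { refl := fun e => ⟨0, by rw [zero_smul, Edge.shift_zero]⟩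
      symm := by
        rintro e _ ⟨ℓ, rfl⟩
        exact ⟨-ℓ, by rw [Edge.shift_shift, ← add_smul, add_neg_cancel, zero_smul,
          Edge.shift_zero]⟩
      trans := by
        rintro e _ _ ⟨ℓ, rfl⟩ ⟨m, rfl⟩
        exact ⟨ℓ + m, by rw [Edge.shift_shift, ← add_smul]⟩ }

/-- The edges of the half-cylinder `𝒞_n` with `n` marked points on its boundary circle. -/
def CylEdge (n : ℕ) : Type := Quotient (translationSetoid n)

/-- The covering map on edges. -/
def proj (n : ℕ) (e : Edge ℤ) : CylEdge n := Quotient.mk (translationSetoid n) e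

/-- The lift `π⁻¹(T)` of a set of edges of the half-cylinder to the universal cover. -/
def lift {n : ℕ} (T : Set (CylEdge n)) : Set (Edge ℤ) := proj n ⁻¹' T

/-- The length `|v - u|` of the edge `[u, v]` of the universal cover. -/
def coverLength (e : Edge ℤ) : ℕ :=
  Sym2.lift ⟨fun u v => (v - u).natAbs, fun u v => by
    change (v - u).natAbs = (u - v).natAbs
    rw [← neg_sub, Int.natAbs_neg]⟩ e.1

theorem coverLength_shift (c : ℤ) (e : Edge ℤ) : coverLength (e.shift c) = coverLength e := by
  obtain ⟨e, he⟩ := e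
  induction e with
  | h u v => simp [coverLength, Edge.shift]

/-- The length of an edge of the half-cylinder. -/
def cylLength {n : ℕ} (e : CylEdge n) : ℕ :=
  Quotient.lift coverLength (by rintro e _ ⟨ℓ, rfl⟩; rw [coverLength_shift]) e

/-- The `k`-triangulations of the half-cylinder: inclusion-maximal sets of edges whose lift to the
universal cover is `(k+1)`-crossing-free. -/
def CylTriangulation (n k : ℕ) : Type :=
  {T : Set (CylEdge n) // Maximal (fun S => CrossingFree (k + 1) (lift S)) T}

/-- `T'` is obtained from `T` by a flip: a `k`-relevant edge of `T` is replaced by an edge that is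
not in `T`. -/
def IsCylFlip {n k : ℕ} (T T' : CylTriangulation n k) : Prop :=
  ∃ e ∈ T.1, (k < cylLength e ∧ cylLength e ≤ k * n) ∧ ∃ f ∉ T.1, T'.1 = (T.1 \ {e}) ∪ {f}

/-- The flip graph of `k`-triangulations of the half-cylinder. -/
def cylFlipGraph (n k : ℕ) : SimpleGraph (CylTriangulation n k) :=
  SimpleGraph.fromRel IsCylFlip

end HalfCylinder

end Multitriangulation

/-! The argument rests on the stars of Pilaud and Santos. In a `2`-triangulation of the `4n`-gon,
two consecutive relevant neighbours seen from a vertex span an angle of exactly one `2`-star, a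
pentagram of five edges (`Tri.star_of_angle`, `Star.unique`). The five angles of a star together
span `4n` sides, while each vertex sees `4n - 4` sides through its angles. Double counting modulo
rotation gives `5(n - 1)` orbits of angles (`Tri.card_angles`). Each angle is recorded by its first
edge, so every relevant non-diameter orbit is counted twice. Since at most one orbit of diameters is
possible, parity leaves exactly `2(n - 1)` orbits of relevant edges (`Tri.card_relevantEdges`).

A relevant edge lies in two stars, and their common bisector is the candidate to replace it. The
delicate point is that a whole orbit is exchanged, and copies of an edge may cross one another. If
an edge can be added but its orbit cannot, then a missing edge joining two vertices a quarter turn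
apart has an orbit that can be added (`free_union_orb_or`). This gives existence of an exchange
(`StarPair.exists_exchange`), and it also shows that maximality among periodic sets implies
maximality among all sets. For uniqueness, a new edge bisects an angle of some star; a `3`-crossing
is avoided only if that star loses an edge, so it is a copy of one of the two stars at the removed
edge. Crossings with the remaining edges single out the common bisector
(`StarPair.unique_exchange`). When the two stars are rotations of each other, fewer edges remain,
and both endpoints of the new edge have to be examined (`StarPair.unique_of_linked`).

An exchange without `3`-crossing is maximal because all triangulations have the same number of
relevant edges. Hence each of the `2(n - 1)` relevant edges yields exactly one neighbour, and
distinct edges yield distinct neighbours. The half-cylinder enters through the bijection between its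
edges of length at most `2n` and the rotation orbits of edges of the `4n`-gon;
`crossingFree_lift_iff` shows that it respects `3`-crossings. -/

namespace Multitriangulation

/-! ### Periodic edge sets and orbits on integer labels -/

/-- A set of edges of the `N`-gon, given by a relation on integer labels, has no `3`-crossing. -/
def Free (N : ℤ) (P : ℤ → ℤ → Prop) : Prop :=
  ∀ a₁ a₂ a₃ b₁ b₂ b₃ : ℤ, a₁ < a₂ ∧ a₂ < a₃ ∧ a₃ < b₁ ∧ b₁ < b₂ ∧ b₂ < b₃ ∧ b₃ < a₁ + N →
    P a₁ b₁ → P a₂ b₂ → P a₃ b₃ → False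

/-- The edge `[u, v]` is crossed by two crossing edges of `P`. -/
def Blocked (N : ℤ) (P : ℤ → ℤ → Prop) (u v : ℤ) : Prop :=
  ∃ a a' b b' : ℤ, (u < a ∧ a < a' ∧ a' < v ∧ v < b ∧ b < b' ∧ b' < u + N) ∧ P a b ∧ P a' b'

/-- The edge `[u, v]` and its rotational copies, on integer labels. -/
def Orb (n p r u v : ℤ) : Prop :=
  ∃ j k : ℤ, (4 : ℤ) ∣ k - j ∧
    ((u = p + j * n ∧ v = r + k * n) ∨ (u = r + j * n ∧ v = p + k * n))

/-- A set of edges of the `4n`-gon invariant under rotation by `n`, given by a relation on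
integer labels. -/
structure Periodic (n : ℤ) (P : ℤ → ℤ → Prop) : Prop where
  symm : ∀ u v, P u v → P v u
  add_right : ∀ u v, P u (v + 4 * n) ↔ P u v
  rot : ∀ u v, P (u + n) (v + n) ↔ P u v
  irrefl : ∀ u, ¬ P u u

theorem Orb.move {n p r u v u' v' : ℤ} (h : Orb n p r u v) (j k : ℤ)
    (hu : u' = u + j * n) (hv : v' = v + k * n) (hjk : (4 : ℤ) ∣ k - j) : Orb n p r u' v' := by
  obtain ⟨x, y, h4, h | h⟩ := h
  · exact ⟨x + j, y + k, by omega, Or.inl ⟨by rw [hu, h.1]; ring, by rw [hv, h.2]; ring⟩⟩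
  · exact ⟨x + j, y + k, by omega, Or.inr ⟨by rw [hu, h.1]; ring, by rw [hv, h.2]; ring⟩⟩

theorem Orb.swap {n p r u v : ℤ} (h : Orb n p r u v) : Orb n p r v u := by
  obtain ⟨x, y, h4, h | h⟩ := h
  · exact ⟨y, x, by omega, Or.inr ⟨h.2, h.1⟩⟩
  · exact ⟨y, x, by omega, Or.inl ⟨h.2, h.1⟩⟩

theorem Orb.refl (n p r : ℤ) : Orb n p r p r := ⟨0, 0, by simp, Or.inl (by simp)⟩

theorem Orb.comm {n p r u v : ℤ} (h : Orb n p r u v) : Orb n u v p r := by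
  obtain ⟨x, y, h4, h | h⟩ := h
  · exact ⟨-x, -y, by omega, Or.inl ⟨by rw [h.1]; ring, by rw [h.2]; ring⟩⟩
  · exact ⟨-y, -x, by omega, Or.inr ⟨by rw [h.2]; ring, by rw [h.1]; ring⟩⟩

theorem Orb.trans {n a b p r u v : ℤ} (h : Orb n p r u v) (h' : Orb n a b p r) :
    Orb n a b u v := by
  obtain ⟨x, y, h4, h | h⟩ := h
  · exact h'.move x y h.1 h.2 h4
  · exact h'.swap.move x y h.1 h.2 h4

namespace Periodic

variable {n : ℤ} {P : ℤ → ℤ → Prop}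

theorem rot_mul (h : Periodic n P) (u v j : ℤ) : P (u + j * n) (v + j * n) ↔ P u v := by
  induction j using Int.induction_on with
  | zero => simp
  | succ j ih => rw [← ih, ← h.rot (u + j * n)]; ring_nf
  | pred j ih => rw [← ih, ← h.rot (u + (-j - 1) * n)]; ring_nf

theorem add_right_mul (h : Periodic n P) (u v j : ℤ) : P u (v + j * (4 * n)) ↔ P u v := by
  induction j using Int.induction_on with
  | zero => simp
  | succ j ih => rw [← ih, ← h.add_right u (v + j * (4 * n))]; ring_nf
  | pred j ih => rw [← ih, ← h.add_right u (v + (-j - 1) * (4 * n))]; ring_nf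

theorem move (h : Periodic n P) {u v : ℤ} (hP : P u v) {u' v' : ℤ} (j k : ℤ)
    (hu : u' = u + j * n) (hv : v' = v + k * n) (hjk : (4 : ℤ) ∣ k - j) : P u' v' := by
  obtain ⟨m, hm⟩ := hjk
  have h1 := (h.add_right_mul _ _ m).2 ((h.rot_mul u v j).2 hP)
  obtain rfl : k = 4 * m + j := by omega
  rw [hu, hv]
  convert h1 using 1
  ring

theorem diff_orb (h : Periodic n P) (p r : ℤ) :
    Periodic n (fun u v => P u v ∧ ¬ Orb n p r u v) where
  symm u v := And.imp (h.symm u v) (mt Orb.swap)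
  add_right u v := and_congr (h.add_right u v) (not_congr
    ⟨fun ho => ho.move 0 (-4) (by ring) (by ring) (by norm_num),
      fun ho => ho.move 0 4 (by ring) (by ring) (by norm_num)⟩)
  rot u v := and_congr (h.rot u v) (not_congr
    ⟨fun ho => ho.move (-1) (-1) (by ring) (by ring) (by norm_num),
      fun ho => ho.move 1 1 (by ring) (by ring) (by norm_num)⟩)
  irrefl u hu := h.irrefl u hu.1

end Periodic

/-- In an orbit, the representatives with ordered endpoints less than a full turn apart. -/
theorem Orb.normal {n u v a b : ℤ} (hn : 0 < n) (h : Orb n u v a b) (huv : u < v)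
    (hvu : v < u + 4 * n) (hab : a < b) (hba : b < a + 4 * n) :
    ∃ t : ℤ, (a = u + t * n ∧ b = v + t * n) ∨ (a = v + t * n ∧ b = u + t * n + 4 * n) := by
  obtain ⟨j, k, ⟨m, hm⟩, h | h⟩ := h
  · refine ⟨j, Or.inl ⟨h.1, ?_⟩⟩
    obtain rfl : k = 4 * m + j := by omega
    have h1 : b - a = v - u + m * (4 * n) := by rw [h.1, h.2]; ring
    have h2 : m < 1 := by
      by_contra hc
      nlinarith
    have h3 : -1 < m := by
      by_contra hc
      nlinarith
    obtain rfl : m = 0 := by omega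
    rw [h.2]; ring
  · refine ⟨j, Or.inr ⟨h.1, ?_⟩⟩
    obtain rfl : k = 4 * m + j := by omega
    have h1 : b - a = u - v + m * (4 * n) := by rw [h.1, h.2]; ring
    have h2 : m < 2 := by
      by_contra hc
      nlinarith
    have h3 : 0 < m := by
      by_contra hc
      nlinarith
    obtain rfl : m = 1 := by omega
    rw [h.2]; ring

/-- An inequality between multiples of `n` bounds the multiplier. -/
theorem lt_of_mul_lt {n c j : ℤ} (hn : 0 < n) (h : c * n < j * n) : c < j :=
  lt_of_mul_lt_mul_right h hn.le

end Multitriangulation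

/-! ### Adding a whole orbit to a periodic set without `3`-crossings -/

namespace Multitriangulation

variable {n : ℤ} {P : ℤ → ℤ → Prop}

theorem Free.mono {N : ℤ} {Q : ℤ → ℤ → Prop} (h : Free N Q) (hPQ : ∀ u v, P u v → Q u v) :
    Free N P := fun a₁ a₂ a₃ b₁ b₂ b₃ ho h1 h2 h3 =>
  h a₁ a₂ a₃ b₁ b₂ b₃ ho (hPQ _ _ h1) (hPQ _ _ h2) (hPQ _ _ h3)

theorem Blocked.mono {N u v : ℤ} {Q : ℤ → ℤ → Prop} (h : Blocked N P u v)
    (hPQ : ∀ u v, P u v → Q u v) : Blocked N Q u v := by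
  obtain ⟨a, a', b, b', ho, h1, h2⟩ := h
  exact ⟨a, a', b, b', ho, hPQ _ _ h1, hPQ _ _ h2⟩

theorem Blocked.swap (hP : Periodic n P) {u v : ℤ} (h : Blocked (4 * n) P u v) :
    Blocked (4 * n) P v (u + 4 * n) := by
  obtain ⟨a, a', b, b', ho, h1, h2⟩ := h
  exact ⟨b, b', a + 4 * n, a' + 4 * n, by omega,
    hP.move (hP.symm _ _ h1) 0 4 (by ring) (by ring) (by norm_num),
    hP.move (hP.symm _ _ h2) 0 4 (by ring) (by ring) (by norm_num)⟩

theorem Blocked.rot (hP : Periodic n P) {u v : ℤ} (h : Blocked (4 * n) P u v) (t : ℤ) :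
    Blocked (4 * n) P (u + t * n) (v + t * n) := by
  obtain ⟨a, a', b, b', ho, h1, h2⟩ := h
  exact ⟨a + t * n, a' + t * n, b + t * n, b' + t * n, by omega, hP.move h1 t t rfl rfl (by simp),
    hP.move h2 t t rfl rfl (by simp)⟩

theorem Blocked.orb (hP : Periodic n P) {u v a b : ℤ} (hn : 0 < n)
    (h : Blocked (4 * n) P a b) (ho : Orb n u v a b) (huv : u < v)
    (hvu : v < u + 4 * n) (hab : a < b) (hba : b < a + 4 * n) : Blocked (4 * n) P u v := by
  obtain ⟨t, ⟨rfl, rfl⟩ | ⟨rfl, rfl⟩⟩ := ho.normal hn huv hvu hab hba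
  · have := h.rot hP (-t)
    convert this using 1 <;> ring
  · have := (h.swap hP).rot hP (-4 - t)
    convert this using 1 <;> ring

/-- A set stays free of `3`-crossings after adding an orbit when no `3`-crossing uses one copy, or
two crossing copies. -/
theorem free_union_orb (hP : Periodic n P) (hF : Free (4 * n) P) (hn : 0 < n) {u v : ℤ}
    (huv : u < v) (hvu : v < u + 4 * n) (hb : ¬ Blocked (4 * n) P u v)
    (htwo : ∀ a₁ a₂ a₃ b₁ b₂ b₃ : ℤ,
      a₁ < a₂ ∧ a₂ < a₃ ∧ a₃ < b₁ ∧ b₁ < b₂ ∧ b₂ < b₃ ∧ b₃ < a₁ + 4 * n →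
      Orb n u v a₁ b₁ → Orb n u v a₂ b₂ → (P a₃ b₃ ∨ Orb n u v a₃ b₃) → False) :
    Free (4 * n) (fun x y => P x y ∨ Orb n u v x y) := by
  have hone : ∀ a₁ a₂ a₃ b₁ b₂ b₃ : ℤ,
      a₁ < a₂ ∧ a₂ < a₃ ∧ a₃ < b₁ ∧ b₁ < b₂ ∧ b₂ < b₃ ∧ b₃ < a₁ + 4 * n →
      Orb n u v a₁ b₁ → P a₂ b₂ → P a₃ b₃ → False := fun a₁ a₂ a₃ b₁ b₂ b₃ ho h1 h2 h3 =>
    hb (Blocked.orb hP hn ⟨a₂, a₃, b₂, b₃, by omega, h2, h3⟩ h1 huv hvu (by omega) (by omega))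
  -- Reading an edge from its other endpoint rotates the cyclic order of a `3`-crossing, so the new
  -- edges can be moved to the front.
  have hs : ∀ x y, P x y → P y (x + 4 * n) := fun x y h =>
    hP.move (hP.symm _ _ h) 0 4 (by ring) (by ring) (by norm_num)
  have ho' : ∀ x y, Orb n u v x y → Orb n u v y (x + 4 * n) := fun x y h =>
    h.swap.move 0 4 (by ring) (by ring) (by norm_num)
  intro a₁ a₂ a₃ b₁ b₂ b₃ ho h1 h2 h3
  rcases h1 with h1 | h1 <;> rcases h2 with h2 | h2
  · rcases h3 with h3 | h3
    · exact hF _ _ _ _ _ _ ho h1 h2 h3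
    · exact hone a₃ b₁ b₂ b₃ (a₁ + 4 * n) (a₂ + 4 * n) (by omega) h3 (hs _ _ h1) (hs _ _ h2)
  · rcases h3 with h3 | h3
    · exact hone a₂ a₃ b₁ b₂ b₃ (a₁ + 4 * n) (by omega) h2 h3 (hs _ _ h1)
    · exact htwo a₂ a₃ b₁ b₂ b₃ (a₁ + 4 * n) (by omega) h2 h3 (Or.inl (hs _ _ h1))
  · rcases h3 with h3 | h3
    · exact hone _ _ _ _ _ _ ho h1 h2 h3
    · exact htwo a₃ b₁ b₂ b₃ (a₁ + 4 * n) (a₂ + 4 * n) (by omega) h3 (ho' _ _ h1)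
        (Or.inl (hs _ _ h2))
  · exact htwo _ _ _ _ _ _ ho h1 h2 h3

/-- Two crossing copies of an edge of length at most `2n` differ by a quarter turn. -/
theorem crossing_copies {a₁ a₂ b₁ b₂ u v : ℤ} (hn : 0 < n) (huv : u < v) (hvu : v ≤ u + 2 * n)
    (ho : a₁ < a₂ ∧ a₂ < b₁ ∧ b₁ < b₂ ∧ b₂ < a₁ + 4 * n)
    (h1 : Orb n u v a₁ b₁) (h2 : Orb n u v a₂ b₂) : u + n < v ∧ ∃ t : ℤ,
      (a₁ = u + t * n ∧ b₁ = v + t * n ∧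
        ((a₂ = a₁ + n ∧ b₂ = b₁ + n) ∨ (a₂ = b₁ - n ∧ b₂ = a₁ + 3 * n))) ∨
      (a₁ = v + t * n ∧ b₁ = u + t * n + 4 * n ∧
        ((a₂ = b₁ - n ∧ b₂ = a₁ + 3 * n) ∨ (a₂ = a₁ + n ∧ b₂ = b₁ + n))) := by
  obtain ⟨t, h1⟩ := h1.normal hn huv (by omega) (by omega) (by omega)
  obtain ⟨s, h2⟩ := h2.normal hn huv (by omega) (by omega) (by omega)
  have hst : s * n = t * n + (s - t) * n := by ring
  generalize s - t = d at hst
  rw [hst] at h2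
  have lo : ∀ c : ℤ, c * n < d * n → c < d := fun c => lt_of_mul_lt hn
  have hi : ∀ c : ℤ, d * n < c * n → d < c := fun c => lt_of_mul_lt hn
  rcases h1 with ⟨h1, h1'⟩ | ⟨h1, h1'⟩ <;> rcases h2 with ⟨h2, h2'⟩ | ⟨h2, h2'⟩
  · obtain rfl : d = 1 := by
      have := lo 0 (by omega); have := hi 2 (by omega); omega
    exact ⟨by omega, t, Or.inl ⟨h1, h1', Or.inl (by omega)⟩⟩
  · obtain rfl : d = -1 := by
      have := lo (-2) (by omega); have := hi 0 (by omega); omega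
    exact ⟨by omega, t, Or.inl ⟨h1, h1', Or.inr (by omega)⟩⟩
  · obtain rfl : d = 3 := by
      have := lo 2 (by omega); have := hi 4 (by omega); omega
    exact ⟨by omega, t, Or.inr ⟨h1, h1', Or.inl (by omega)⟩⟩
  · obtain rfl : d = 1 := by
      have := lo 0 (by omega); have := hi 2 (by omega); omega
    exact ⟨by omega, t, Or.inr ⟨h1, h1', Or.inr (by omega)⟩⟩

/-- If an edge of length at most `2n` can be added but its orbit cannot, then some edge of `P`
of length at most `n` crosses the edge and its image under a quarter turn. -/
theorem exists_short_of_not_free (hP : Periodic n P) (hF : Free (4 * n) P) (hn : 0 < n) {u v : ℤ}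
    (huv : u < v) (hvu : v ≤ u + 2 * n) (hb : ¬ Blocked (4 * n) P u v)
    (hnf : ¬ Free (4 * n) (fun x y => P x y ∨ Orb n u v x y)) :
    u + n < v ∧ v < u + 2 * n ∧
      ∃ x y, u < x ∧ x < u + n ∧ v < y ∧ y < v + n ∧ y ≤ x + n ∧ P x y := by
  by_contra hcon
  refine hnf (free_union_orb hP hF hn huv (by omega) hb ?_)
  -- an edge crossing the edge and its quarter turn
  have inner : ∀ x y, u < x → x < u + n → v < y → y < v + n → u + n < v → P x y → False := by
    intro x y h1 h2 h3 h4 h5 hxy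
    -- If `[x, y]` were longer than `n`, it would cross its own quarter turn, and both would cross
    -- `[u, v]`.
    have hlen : y ≤ x + n := by
      by_contra hlen
      exact hb ⟨x, y - n, y, x + 3 * n, by omega, hxy,
        hP.move (hP.symm _ _ hxy) (-1) 3 (by ring) (by ring) (by norm_num)⟩
    exact hcon ⟨h5, by omega, x, y, h1, h2, h3, h4, hlen, hxy⟩
  have outer : ∀ x y, u + n < x → x < v → v + n < y → y < u + 4 * n → P x y → False := by
    intro x y h1 h2 h3 h4 hxy
    exact hb ⟨x - n, x, y - n, y, by omega,
      hP.move hxy (-1) (-1) (by ring) (by ring) (by norm_num), hxy⟩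
  intro a₁ a₂ a₃ b₁ b₂ b₃ ho h1 h2 h3
  have h23 := crossing_copies hn huv hvu (by omega) h1 h2
  rcases h3 with h3 | h3
  · obtain ⟨hd, t, ⟨e1, e2, ⟨e3, e4⟩ | ⟨e3, e4⟩⟩ | ⟨e1, e2, ⟨e3, e4⟩ | ⟨e3, e4⟩⟩⟩ := h23
    · exact outer (a₃ - t * n) (b₃ - t * n) (by omega) (by omega) (by omega) (by omega)
        (hP.move h3 (-t) (-t) (by ring) (by ring) (by simp))
    · exact inner (b₃ - t * n - 3 * n) (a₃ - t * n + n) (by omega) (by omega) (by omega) (by omega)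
        hd (hP.move (hP.symm _ _ h3) (-t - 3) (-t + 1) (by ring) (by ring) (by ring_nf; norm_num))
    · exact inner (a₃ - t * n - 3 * n) (b₃ - t * n - 3 * n) (by omega) (by omega) (by omega)
        (by omega) hd (hP.move h3 (-t - 3) (-t - 3) (by ring) (by ring) (by simp))
    · exact outer (b₃ - t * n - 4 * n) (a₃ - t * n) (by omega) (by omega) (by omega) (by omega)
        (hP.move (hP.symm _ _ h3) (-t - 4) (-t) (by ring) (by ring) (by ring_nf; norm_num))
  · obtain ⟨s, h3⟩ := h3.normal hn huv (by omega) (by omega) (by omega)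
    obtain ⟨hd, t, h⟩ := h23
    -- Three copies cannot differ pairwise by a quarter turn. Writing the third relative to the
    -- first leaves finitely many multipliers `d` to exclude.
    have hst : s * n = t * n + (s - t) * n := by ring
    generalize s - t = d at hst
    rw [hst] at h3
    have lo : ∀ c : ℤ, c * n < d * n → c < d := fun c => lt_of_mul_lt hn
    have hi : ∀ c : ℤ, d * n < c * n → d < c := fun c => lt_of_mul_lt hn
    have hl := lo (-3); have hl1 := lo (-2); have hl2 := lo (-1); have hl3 := lo 0
    have hl4 := lo 1; have hl5 := lo 2; have hl6 := lo 3
    have hh := hi (-2); have hh1 := hi (-1); have hh2 := hi 0; have hh3 := hi 1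
    have hh4 := hi 2; have hh5 := hi 3; have hh6 := hi 4
    rcases h with ⟨e1, e2, ⟨e3, e4⟩ | ⟨e3, e4⟩⟩ | ⟨e1, e2, ⟨e3, e4⟩ | ⟨e3, e4⟩⟩ <;>
      rcases h3 with ⟨h3, h4⟩ | ⟨h3, h4⟩ <;> omega

/-- If an edge `[u, v]` of length between `n` and `2n` can be added but its orbit cannot, then
`[u, u + n]` is a missing edge that can be added. -/
theorem quarter_edge_of_short (hP : Periodic n P) {u v x y : ℤ}
    (hb : ¬ Blocked (4 * n) P u v) (h1 : u + n < v) (h2 : v < u + 2 * n)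
    (hx : u < x) (hx' : x < u + n) (hy : v < y) (hy' : y < v + n) (hyx : y ≤ x + n)
    (hxy : P x y) : ¬ P u (u + n) ∧ ¬ Blocked (4 * n) P u (u + n) := by
  constructor
  · intro h
    exact hb ⟨x, u + n, y, u + 2 * n, by omega, hxy,
      hP.move h 1 1 (by ring) (by ring) (by norm_num)⟩
  · intro h
    -- The pair blocking the quarter edge is rotated to `[u + n, u + 2n]`. The bounds `c1`, `c2`,
    -- `c3` then place it so that its second edge and `[x + n, y + n]` block a copy of `[u, v]`.
    have h := h.rot hP 1
    obtain ⟨a, a', b, b', ho, hab, hab'⟩ := h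
    have hb1 : ¬ Blocked (4 * n) P (u + n) (v + n) := fun hc => hb (by
      have := hc.rot hP (-1); convert this using 1 <;> ring)
    have hb2 : ¬ Blocked (4 * n) P (u + 2 * n) (v + 2 * n) := fun hc => hb (by
      have := hc.rot hP (-2); convert this using 1 <;> ring)
    have hxy1 : P (x + n) (y + n) := (hP.rot _ _).2 hxy
    have c1 : v + 3 * n ≤ b' + n := by
      by_contra hc
      exact hb2 ⟨b, b', a + 4 * n, a' + 4 * n, by omega,
        hP.move (hP.symm _ _ hab) 0 4 (by ring) (by ring) (by norm_num),
        hP.move (hP.symm _ _ hab') 0 4 (by ring) (by ring) (by norm_num)⟩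
    have c2 : b ≤ v + n := by
      by_contra hc
      exact hb1 ⟨a, a', b, b', by omega, hab, hab'⟩
    have c3 : x + n ≤ a := by
      by_contra hc
      exact hb2 ⟨b, y + n, a + 4 * n, x + n + 4 * n, by omega,
        hP.move (hP.symm _ _ hab) 0 4 (by ring) (by ring) (by norm_num),
        hP.move (hP.symm _ _ hxy1) 0 4 (by ring) (by ring) (by norm_num)⟩
    exact hb1 ⟨x + n, a', y + n, b', by omega, hxy1, hab'⟩

/-- An edge that can be added to a periodic set can be added with its orbit, or else some other
missing edge joining two vertices a quarter turn apart, at one of its endpoints, can. -/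
theorem free_union_orb_or (hP : Periodic n P) (hF : Free (4 * n) P) (hn : 0 < n) {u v : ℤ}
    (huv : u < v) (hvu : v < u + 4 * n) (hb : ¬ Blocked (4 * n) P u v) :
    Free (4 * n) (fun x y => P x y ∨ Orb n u v x y) ∨
    ((u + n < v ∧ v < u + 2 * n) ∧ ¬ P u (u + n) ∧
      Free (4 * n) (fun x y => P x y ∨ Orb n u (u + n) x y)) ∨
    ((u + 2 * n < v ∧ v < u + 3 * n) ∧ ¬ P v (v + n) ∧
      Free (4 * n) (fun x y => P x y ∨ Orb n v (v + n) x y)) := by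
  have key : ∀ w, ¬ Blocked (4 * n) P w (w + n) →
      Free (4 * n) (fun x y => P x y ∨ Orb n w (w + n) x y) := by
    intro w hw
    by_contra hc
    -- Only copies of an edge longer than `n` can cross, so an edge of length exactly `n` is never
    -- obstructed by its own orbit.
    have := exists_short_of_not_free hP hF hn (by omega) (by omega) hw hc
    omega
  rcases le_or_gt v (u + 2 * n) with h | h
  · by_cases hf : Free (4 * n) (fun x y => P x y ∨ Orb n u v x y)
    · exact Or.inl hf
    · obtain ⟨h1, h2, x, y, h3, h4, h5, h6, h7, h8⟩ :=
        exists_short_of_not_free hP hF hn huv h hb hf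
      obtain ⟨h9, h10⟩ := quarter_edge_of_short hP hb h1 h2 h3 h4 h5 h6 h7 h8
      exact Or.inr (Or.inl ⟨⟨h1, h2⟩, h9, key _ h10⟩)
  · have hb' : ¬ Blocked (4 * n) P v (u + 4 * n) := fun hc => hb (by
      have := (hc.swap hP).rot hP (-4); convert this using 1 <;> ring)
    have hO : ∀ x y, Orb n u v x y → Orb n v (u + 4 * n) x y := fun x y ho =>
      ho.trans ((Orb.refl n v (u + 4 * n)).swap.move (-4) 0 (by ring) (by ring) (by norm_num))
    by_cases hf : Free (4 * n) (fun x y => P x y ∨ Orb n v (u + 4 * n) x y)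
    · exact Or.inl (hf.mono fun x y => Or.imp_right (hO x y))
    · obtain ⟨h1, h2, x, y, h3, h4, h5, h6, h7, h8⟩ :=
        exists_short_of_not_free hP hF hn (by omega) (by omega) hb' hf
      obtain ⟨h9, h10⟩ := quarter_edge_of_short hP hb' h1 h2 h3 h4 h5 h6 h7 h8
      exact Or.inr (Or.inr ⟨by omega, h9, key _ h10⟩)

end Multitriangulation

/-! ### Stars: existence and uniqueness -/

namespace Multitriangulation

variable {n : ℤ} {P : ℤ → ℤ → Prop}

/-- A periodic `2`-triangulation of the `4n`-gon, on integer labels. -/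
structure Tri (n : ℤ) (P : ℤ → ℤ → Prop) : Prop extends Periodic n P where
  pos : 0 < n
  free : Free (4 * n) P
  blocked : ∀ u v, u < v → v < u + 4 * n → ¬ P u v → Blocked (4 * n) P u v

/-- A `2`-star: the five longest edges between five vertices, every angle of which spans two. -/
structure Star (n : ℤ) (P : ℤ → ℤ → Prop) (x₀ x₁ x₂ x₃ x₄ : ℤ) : Prop where
  lt : x₀ < x₁ ∧ x₁ < x₂ ∧ x₂ < x₃ ∧ x₃ < x₄ ∧ x₄ < x₀ + 4 * n
  h02 : P x₀ x₂
  h03 : P x₀ x₃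
  h13 : P x₁ x₃
  h14 : P x₁ x₄
  h24 : P x₂ x₄

namespace Tri

theorem short (h : Tri n P) {u v : ℤ} (huv : u < v) (hvu : v ≤ u + 2) (hn : v < u + 4 * n) :
    P u v := by
  by_contra hc
  obtain ⟨a, a', b, b', ho, -⟩ := h.blocked u v huv hn hc
  omega

theorem short' (h : Tri n P) {u v : ℤ} (huv : u + 4 * n - 2 ≤ v) (hn : v < u + 4 * n)
    (hn2 : u < v) : P u v := by
  by_contra hc
  obtain ⟨a, a', b, b', ho, -⟩ := h.blocked u v hn2 hn hc
  omega

/-- Two consecutive edges at a vertex are two consecutive edges of a star. -/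
theorem star_of_angle (h : Tri n P) {v w u : ℤ} (hw : v + 2 ≤ w) (hwu : w < u)
    (hu : u ≤ v + 4 * n - 2) (hvw : P v w) (hvu : P v u) (hno : ∀ x, w < x → x < u → ¬ P v x) :
    ∃ s t, Star n P v s w u t := by
  classical
  -- Among the edges separating `v` from both `w` and `u`, the one closest to the angle supplies `s`
  -- and `t`. The edge joining the two neighbours of `v` shows that there is one.
  have hex : ∃ k : ℕ, ∃ a b, v < a ∧ a < w ∧ u < b ∧ b < v + 4 * n ∧ P a b ∧ b - a = k :=
    ⟨(4 * n - 2).toNat, v + 1, v + 4 * n - 1, by omega, by omega, by omega, by omega,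
      h.short' (by omega) (by omega) (by omega), by omega⟩
  obtain ⟨s, t, hs1, hs2, ht1, ht2, hst, hk⟩ := Nat.find_spec hex
  have hmin : ∀ a b, v < a → a < w → u < b → b < v + 4 * n → P a b → t - s ≤ b - a := by
    intro a b h1 h2 h3 h4 h5
    have := Nat.find_min' hex (m := (b - a).toNat) ⟨a, b, h1, h2, h3, h4, h5, by omega⟩
    omega
  have hF := h.free
  refine ⟨s, t, ⟨by omega, hvw, hvu, ?_, hst, ?_⟩⟩
  -- Were `[s, u]` missing, freeness, the choice of `[s, t]` and the emptiness of the angle would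
  -- force the second edge of a blocking pair to form a `3`-crossing with `[v, w]` and `[s, t]`. The
  -- argument for `[w, t]` is the mirror image, with `[v, u]` in place of `[v, w]`.
  · by_contra hc
    obtain ⟨c, c', d, d', ho, hcd, hcd'⟩ := h.blocked s u (by omega) (by omega) hc
    have e1 : v + 4 * n ≤ d' := by
      by_contra he
      exact hF v c c' u d d' (by omega) hvu hcd hcd'
    have e2 : d ≤ t := by
      by_contra he
      exact hF s c c' t d d' (by omega) hst hcd hcd'
    have e3 : w ≤ c := by
      by_contra he
      have := hmin c d (by omega) (by omega) (by omega) (by omega) hcd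
      omega
    have e4 : d' ≠ v + 4 * n := by
      rintro rfl
      exact hno c' (by omega) (by omega) (h.symm _ _ ((h.add_right _ _).1 hcd'))
    exact hF v (d' - 4 * n) s w c' t (by omega) hvw
      (h.move (h.symm _ _ hcd') (-4) 0 (by ring) (by ring) (by norm_num)) hst
  · by_contra hc
    obtain ⟨c', c, d', d, ho, hcd', hcd⟩ := h.blocked w t (by omega) (by omega) hc
    have hcd1 : P (d - 4 * n) c := h.move (h.symm _ _ hcd) (-4) 0 (by ring) (by ring) (by norm_num)
    have hcd2 : P (d' - 4 * n) c' :=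
      h.move (h.symm _ _ hcd') (-4) 0 (by ring) (by ring) (by norm_num)
    have e1 : d' - 4 * n ≤ v := by
      by_contra he
      exact hF v (d' - 4 * n) (d - 4 * n) w c' c (by omega) hvw hcd2 hcd1
    have e2 : s ≤ d - 4 * n := by
      by_contra he
      exact hF (d' - 4 * n) (d - 4 * n) s c' c t (by omega) hcd2 hcd1 hst
    have e3 : c ≤ u := by
      by_contra he
      have := hmin (d - 4 * n) c (by omega) (by omega) (by omega) (by omega) hcd1
      omega
    have e4 : d' - 4 * n ≠ v := by
      intro he
      exact hno c' (by omega) (by omega) (he ▸ hcd2)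
    exact hF v s c' u t d' (by omega) hvu hst hcd'

/-- Every gap `j, j + 1` seen from a vertex lies in an angle of a star at this vertex. -/
theorem exists_star (h : Tri n P) {v j : ℤ} (hv : v + 2 ≤ j) (hj : j < v + 4 * n - 2) :
    ∃ s w u t, Star n P v s w u t ∧ w ≤ j ∧ j < u := by
  obtain ⟨w, ⟨hw1, hw2⟩, hw3⟩ := Int.exists_greatest_of_bdd (P := fun x => x ≤ j ∧ P v x)
    ⟨j, fun z hz => hz.1⟩ ⟨v + 2, hv, h.short (by omega) (by omega) (by omega)⟩
  obtain ⟨u, ⟨hu1, hu2⟩, hu3⟩ := Int.exists_least_of_bdd (P := fun x => j < x ∧ P v x)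
    ⟨j, fun z hz => hz.1.le⟩
    ⟨v + 4 * n - 2, hj, h.short' (by omega) (by omega) (by omega)⟩
  have h1 := hw3 (v + 2) ⟨hv, h.short (by omega) (by omega) (by omega)⟩
  have h2 := hu3 (v + 4 * n - 2) ⟨hj, h.short' (by omega) (by omega) (by omega)⟩
  obtain ⟨s, t, hst⟩ := h.star_of_angle h1 (by omega) h2 hw2 hu2 (fun x hx hx' hvx => by
    rcases le_or_gt x j with hxj | hxj
    · have := hw3 x ⟨hxj, hvx⟩
      omega
    · have := hu3 x ⟨hxj, hvx⟩
      omega)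
  exact ⟨s, w, u, t, hst, by omega, by omega⟩

end Tri

namespace Star

variable {x₀ x₁ x₂ x₃ x₄ y₁ y₂ y₃ y₄ : ℤ}

theorem rotate (h : Star n P x₀ x₁ x₂ x₃ x₄) (hP : Periodic n P) :
    Star n P x₁ x₂ x₃ x₄ (x₀ + 4 * n) := by
  have hl := h.lt
  exact ⟨by omega, h.h13, h.h14, h.h24,
    hP.move (hP.symm _ _ h.h02) 0 4 (by ring) (by ring) (by norm_num),
    hP.move (hP.symm _ _ h.h03) 0 4 (by ring) (by ring) (by norm_num)⟩

theorem rot (h : Star n P x₀ x₁ x₂ x₃ x₄) (hP : Periodic n P) (t : ℤ) :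
    Star n P (x₀ + t * n) (x₁ + t * n) (x₂ + t * n) (x₃ + t * n) (x₄ + t * n) := by
  have hl := h.lt
  exact ⟨by omega, (hP.rot_mul _ _ t).2 h.h02, (hP.rot_mul _ _ t).2 h.h03,
    (hP.rot_mul _ _ t).2 h.h13, (hP.rot_mul _ _ t).2 h.h14, (hP.rot_mul _ _ t).2 h.h24⟩

/-- A bisector of the angle at `x₀` forms a `3`-crossing with the two opposite edges `[x₁, x₃]` and
`[x₂, x₄]`. -/
theorem not_bisected (h : Star n P x₀ x₁ x₂ x₃ x₄) (hF : Free (4 * n) P) {y : ℤ}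
    (h2 : x₂ < y) (h3 : y < x₃) : ¬ P x₀ y := fun hy => by
  have hl := h.lt
  exact hF x₀ x₁ x₂ y x₃ x₄ (by omega) hy h.h13 h.h24

/-- The star containing a given angle is unique. -/
theorem unique (h : Star n P x₀ x₁ x₂ x₃ x₄) (h' : Star n P x₀ y₁ y₂ y₃ y₄)
    (hF : Free (4 * n) P) {j : ℤ} (h1 : x₂ ≤ j) (h2 : j < x₃) (h3 : y₂ ≤ j) (h4 : j < y₃) :
    x₁ = y₁ ∧ x₂ = y₂ ∧ x₃ = y₃ ∧ x₄ = y₄ := by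
  have hl := h.lt
  have hl' := h'.lt
  have e2 : x₂ = y₂ := by
    by_contra he
    rcases lt_or_gt_of_ne he with he | he
    · exact h.not_bisected hF he (by omega) h'.h02
    · exact h'.not_bisected hF he (by omega) h.h02
  have e3 : x₃ = y₃ := by
    by_contra he
    rcases lt_or_gt_of_ne he with he | he
    · exact h'.not_bisected hF (by omega) he h.h03
    · exact h.not_bisected hF (by omega) he h'.h03
  subst e2 e3
  refine ⟨?_, rfl, rfl, ?_⟩
  · by_contra he
    rcases lt_or_gt_of_ne he with he | he
    · exact hF x₀ x₁ y₁ x₂ x₃ y₄ (by omega) h.h02 h.h13 h'.h14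
    · exact hF x₀ y₁ x₁ x₂ x₃ x₄ (by omega) h.h02 h'.h13 h.h14
  · by_contra he
    rcases lt_or_gt_of_ne he with he | he
    · exact hF x₀ x₁ x₂ x₃ x₄ y₄ (by omega) h.h03 h.h14 h'.h24
    · exact hF x₀ y₁ x₂ x₃ y₄ x₄ (by omega) h.h03 h'.h14 h.h24

end Star
end Multitriangulation

/-! ### Counting orbits of angles and of relevant edges -/

namespace Multitriangulation

variable {n : ℤ} {P : ℤ → ℤ → Prop}

open Classical in
/-- The number of orbits of edges of `P` joining a vertex to the one `ℓ` steps further. -/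
noncomputable def lengthCount (n : ℤ) (P : ℤ → ℤ → Prop) (ℓ : ℤ) : ℕ :=
  {v ∈ Finset.Ico 0 n | P v (v + ℓ)}.card

open Classical in
theorem card_filter_product_eq_sum (S : Finset ℤ) :
    {p ∈ Finset.Ico 0 n ×ˢ S | P p.1 (p.1 + p.2)}.card = ∑ ℓ ∈ S, lengthCount n P ℓ := by
  rw [Finset.card_filter, Finset.sum_product_right]
  refine Finset.sum_congr rfl fun ℓ _ => ?_
  rw [lengthCount, Finset.card_filter]

theorem Periodic.of_emod (hP : Periodic n P) {u v : ℤ} (h : P u v) :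
    P (u % n) (v - u + u % n) :=
  hP.move h (-(u / n)) (-(u / n)) (by linarith [Int.emod_add_mul_ediv u n])
    (by linarith [Int.emod_add_mul_ediv u n]) (by simp)

/-- An edge that advances `ℓ` steps from one endpoint advances `4n - ℓ` steps from the other. -/
theorem lengthCount_symm (hP : Periodic n P) (hn : 0 < n) (ℓ : ℤ) :
    lengthCount n P (4 * n - ℓ) = lengthCount n P ℓ := by
  classical
  have key : ∀ ℓ v, v ∈ {v ∈ Finset.Ico 0 n | P v (v + ℓ)} →
      (v + ℓ) % n ∈ {v ∈ Finset.Ico 0 n | P v (v + (4 * n - ℓ))} := by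
    intro ℓ v hv
    simp only [Finset.mem_filter, Finset.mem_Ico] at hv ⊢
    refine ⟨⟨Int.emod_nonneg _ hn.ne', Int.emod_lt_of_pos _ hn⟩, ?_⟩
    have h1 : P (v + ℓ) (v + 4 * n) := (hP.add_right _ _).2 (hP.symm _ _ hv.2)
    have h2 := hP.of_emod h1
    convert h2 using 1
    ring
  have inv : ∀ ℓ v, v ∈ {v ∈ Finset.Ico 0 n | P v (v + ℓ)} →
      ((v + ℓ) % n + (4 * n - ℓ)) % n = v := by
    intro ℓ v hv
    simp only [Finset.mem_filter, Finset.mem_Ico] at hv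
    rw [Int.emod_add_emod, show v + ℓ + (4 * n - ℓ) = v + n * 4 by ring, Int.add_mul_emod_self_left]
    exact Int.emod_eq_of_lt hv.1.1 hv.1.2
  refine Finset.card_bij' (fun v _ => (v + (4 * n - ℓ)) % n) (fun v _ => (v + ℓ) % n) ?_ ?_ ?_ ?_
  · intro v hv
    have := key (4 * n - ℓ) v hv
    rwa [show 4 * n - (4 * n - ℓ) = ℓ by ring] at this
  · intro v hv
    exact key ℓ v hv
  · intro v hv
    have := inv (4 * n - ℓ) v hv
    rwa [show 4 * n - (4 * n - ℓ) = ℓ by ring] at this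
  · intro v hv
    exact inv ℓ v hv

/-- At most one orbit of diameters avoids `3`-crossings. -/
theorem Free.diameter_unique (hF : Free (4 * n) P) (hP : Periodic n P) {u v : ℤ}
    (hu : P u (u + 2 * n)) (hv : P v (v + 2 * n)) (huv : u < v) (hvu : v < u + n) : False :=
  hF u v (u + n) (u + 2 * n) (v + 2 * n) (u + 3 * n) (by omega) hu hv
    (hP.move hu 1 1 (by ring) (by ring) (by norm_num))

theorem lengthCount_diameter_le (hF : Free (4 * n) P) (hP : Periodic n P) :
    lengthCount n P (2 * n) ≤ 1 := by
  classical
  rw [lengthCount, Finset.card_le_one]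
  intro u hu v hv
  simp only [Finset.mem_filter, Finset.mem_Ico] at hu hv
  by_contra hne
  rcases lt_or_gt_of_ne hne with h | h
  · exact hF.diameter_unique hP hu.2 hv.2 h (by omega)
  · exact hF.diameter_unique hP hv.2 hu.2 h (by omega)

/-- The star `x` contains the angle starting with the edge from `α.1` to `α.1 + α.2`, up to
rotation by multiples of `n`. -/
def StarAt (n : ℤ) (P : ℤ → ℤ → Prop) (α : ℤ × ℤ) (x₀ x₁ x₂ x₃ x₄ : ℤ) : Prop :=
  Star n P x₀ x₁ x₂ x₃ x₄ ∧ α = (x₀ % n, x₂ - x₀)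

namespace StarAt

variable {α : ℤ × ℤ} {x₀ x₁ x₂ x₃ x₄ y₀ y₁ y₂ y₃ y₄ : ℤ}

theorem unique (hP : Tri n P) (h : StarAt n P α x₀ x₁ x₂ x₃ x₄)
    (h' : StarAt n P α y₀ y₁ y₂ y₃ y₄) : ∃ t, y₀ = x₀ + t * n ∧ y₁ = x₁ + t * n ∧
      y₂ = x₂ + t * n ∧ y₃ = x₃ + t * n ∧ y₄ = x₄ + t * n := by
  obtain ⟨hx, rfl⟩ := h
  obtain ⟨hy, he⟩ := h'
  obtain ⟨e1, e2⟩ := Prod.mk.inj he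
  obtain ⟨t, ht⟩ : n ∣ y₀ - x₀ := Int.ModEq.dvd e1
  have hx' := hx.rot hP.toPeriodic t
  obtain rfl : y₀ = x₀ + t * n := by linarith
  have hl := hx.lt
  have hl' := hy.lt
  obtain ⟨h1, h2, h3, h4⟩ := hx'.unique hy hP.free (j := y₂) (by omega) (by omega) le_rfl
    (by omega)
  exact ⟨t, rfl, h1.symm, h2.symm, h3.symm, h4.symm⟩

theorem rotate (hP : Tri n P) (h : StarAt n P α x₀ x₁ x₂ x₃ x₄) :
    StarAt n P (x₁ % n, x₃ - x₁) x₁ x₂ x₃ x₄ (x₀ + 4 * n) :=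
  ⟨h.1.rotate hP.toPeriodic, rfl⟩

end StarAt

open Classical in
/-- The angles of `P`, up to rotation: `(v, ℓ)` stands for the angle at `v` between `v + ℓ` and the
next neighbour of `v`. -/
noncomputable def angles (n : ℤ) (P : ℤ → ℤ → Prop) : Finset (ℤ × ℤ) :=
  {p ∈ Finset.Ico 0 n ×ˢ Finset.Icc 2 (4 * n - 3) | P p.1 (p.1 + p.2)}

theorem mem_angles {α : ℤ × ℤ} : α ∈ angles n P ↔
    ((0 ≤ α.1 ∧ α.1 < n) ∧ 2 ≤ α.2 ∧ α.2 ≤ 4 * n - 3) ∧ P α.1 (α.1 + α.2) := by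
  classical
  simp [angles, Finset.mem_product]

theorem Tri.exists_star_of_edge (hP : Tri n P) {u v : ℤ} (h2 : u + 2 ≤ v) (h3 : v ≤ u + 4 * n - 3)
    (h : P u v) : ∃ s x t, Star n P u s v x t := by
  obtain ⟨s, w, x, t, hst, h4, h5⟩ := hP.exists_star h2 (by omega)
  obtain rfl : w = v := by
    by_contra hne
    exact hst.not_bisected hP.free (by omega) h5 h
  exact ⟨s, x, t, hst⟩

theorem Tri.exists_star_of_edge' (hP : Tri n P) {u v : ℤ} (h2 : u + 3 ≤ v)
    (h3 : v ≤ u + 4 * n - 2) (h : P u v) : ∃ s w t, Star n P u s w v t := by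
  obtain ⟨s, w, x, t, hst, h4, h5⟩ := hP.exists_star (v := u) (j := v - 1) (by omega) (by omega)
  obtain rfl : x = v := by
    by_contra hne
    exact hst.not_bisected hP.free (y := v) (by omega) (by omega) h
  exact ⟨s, w, t, hst⟩

theorem Tri.exists_starAt (hP : Tri n P) {α : ℤ × ℤ} (h : α ∈ angles n P) :
    ∃ s x t, StarAt n P α α.1 s (α.1 + α.2) x t := by
  rw [mem_angles] at h
  obtain ⟨s, x, t, hst⟩ := hP.exists_star_of_edge (by omega) (by omega) h.2
  exact ⟨s, x, t, hst, by rw [Int.emod_eq_of_lt h.1.1.1 h.1.1.2]; simp⟩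

theorem StarAt.mem_angles (hP : Tri n P) {α : ℤ × ℤ} {x₀ x₁ x₂ x₃ x₄ : ℤ}
    (h : StarAt n P α x₀ x₁ x₂ x₃ x₄) : α ∈ angles n P := by
  obtain ⟨hs, rfl⟩ := h
  have hl := hs.lt
  have hn := hP.pos
  rw [Multitriangulation.mem_angles]
  refine ⟨⟨⟨Int.emod_nonneg _ hn.ne', Int.emod_lt_of_pos _ hn⟩, by dsimp; omega, by dsimp; omega⟩, ?_⟩
  have := hP.of_emod hs.h02
  convert this using 1
  ring

/-- Double counting of the widths of the angles. Around a star the five widths add up to `4n`,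
whereas the angles at one vertex partition `4n - 4` sides. -/
theorem Tri.card_angles (hP : Tri n P) : ((angles n P).card : ℤ) = 5 * (n - 1) := by
  classical
  have hn := hP.pos
  have hex : ∀ α : ℤ × ℤ, ∃ x₀ x₁ x₂ x₃ x₄, α ∈ angles n P → StarAt n P α x₀ x₁ x₂ x₃ x₄ := by
    intro α
    by_cases h : α ∈ angles n P
    · obtain ⟨s, x, t, hs⟩ := hP.exists_starAt h
      exact ⟨_, _, _, _, _, fun _ => hs⟩
    · exact ⟨0, 0, 0, 0, 0, fun h' => absurd h' h⟩
  choose X₀ X₁ X₂ X₃ X₄ hX using hex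
  -- `φ` passes to the next angle of the same star and `g` is the width of an angle. The chosen star
  -- is determined only up to rotation by multiples of `n`, so `hgx` and `hφx` check independence of
  -- the choice.
  set φ : ℤ × ℤ → ℤ × ℤ := fun α => (X₁ α % n, X₃ α - X₁ α) with hφ
  set g : ℤ × ℤ → ℤ := fun α => X₃ α - X₂ α with hg
  have hgx : ∀ {α : ℤ × ℤ} {x₀ x₁ x₂ x₃ x₄ : ℤ}, StarAt n P α x₀ x₁ x₂ x₃ x₄ →
      g α = x₃ - x₂ := by
    intro α x₀ x₁ x₂ x₃ x₄ h
    obtain ⟨t, h0, h1, h2, h3, h4⟩ := h.unique hP (hX α (h.mem_angles hP))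
    simp only [hg, h2, h3]; ring
  have hφx : ∀ {α : ℤ × ℤ} {x₀ x₁ x₂ x₃ x₄ : ℤ}, StarAt n P α x₀ x₁ x₂ x₃ x₄ →
      StarAt n P (φ α) x₁ x₂ x₃ x₄ (x₀ + 4 * n) := by
    intro α x₀ x₁ x₂ x₃ x₄ h
    obtain ⟨t, h0, h1, h2, h3, h4⟩ := h.unique hP (hX α (h.mem_angles hP))
    have := h.rotate hP
    simp only [hφ, h1, h3, Int.add_mul_emod_self_right]
    convert this using 2
    ring
  have hmaps : ∀ α ∈ angles n P, φ α ∈ angles n P := fun α hα =>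
    (hφx (hX α hα)).mem_angles hP
  have hinj : Set.InjOn φ (angles n P) := by
    intro α hα β hβ h
    have h1 := hφx (hX α hα)
    have h2 := hφx (hX β hβ)
    rw [h] at h1
    obtain ⟨t, h3, h4, h5, h6, h7⟩ := h1.unique hP h2
    rw [(hX α hα).2, (hX β hβ).2, show X₀ β = X₀ α + t * n by linarith, h4]
    simp
  have hsum : ∀ f : ℤ × ℤ → ℤ, ∑ α ∈ angles n P, f (φ α) = ∑ α ∈ angles n P, f α := by
    intro f
    have himg : (angles n P).image φ = angles n P :=
      Finset.eq_of_subset_of_card_le (Finset.image_subset_iff.2 hmaps)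
        (Finset.card_image_of_injOn hinj).ge
    conv_rhs => rw [← himg, Finset.sum_image hinj]
  -- As `φ` permutes the angles, each of the five summands has the same total.
  have hfive : ∑ α ∈ angles n P, (g α + g (φ α) + g (φ (φ α)) + g (φ (φ (φ α))) +
      g (φ (φ (φ (φ α))))) = 5 * ∑ α ∈ angles n P, g α := by
    simp only [Finset.sum_add_distrib]
    rw [hsum g, hsum (fun α => g (φ α)), hsum (fun α => g (φ (φ α))),
      hsum (fun α => g (φ (φ (φ α)))), hsum g, hsum (fun α => g (φ α)),
      hsum (fun α => g (φ (φ α))), hsum g, hsum (fun α => g (φ α)), hsum g]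
    ring
  have hfull : ∀ α ∈ angles n P, g α + g (φ α) + g (φ (φ α)) + g (φ (φ (φ α))) +
      g (φ (φ (φ (φ α)))) = 4 * n := by
    intro α hα
    have h0 := hX α hα
    have h1 := hφx h0
    have h2 := hφx h1
    have h3 := hφx h2
    have h4 := hφx h3
    rw [hgx h0, hgx h1, hgx h2, hgx h3, hgx h4]
    ring
  rw [Finset.sum_congr rfl hfull, Finset.sum_const, nsmul_eq_mul] at hfive
  -- the gaps seen from a vertex are distributed among the angles at this vertex
  set B : Finset (ℤ × ℤ) := Finset.Ico 0 n ×ˢ Finset.Ico 2 (4 * n - 2) with hB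
  have hψex : ∀ β : ℤ × ℤ, ∃ α : ℤ × ℤ, β ∈ B → α ∈ angles n P ∧ α.1 = β.1 ∧ α.2 ≤ β.2 ∧
      β.2 < α.2 + g α := by
    intro β
    by_cases h : β ∈ B
    · simp only [hB, Finset.mem_product, Finset.mem_Ico] at h
      obtain ⟨s, w, u, t, hst, h1, h2⟩ := hP.exists_star (v := β.1) (j := β.1 + β.2) (by omega)
        (by omega)
      have hR : StarAt n P (β.1, w - β.1) β.1 s w u t :=
        ⟨hst, by rw [Int.emod_eq_of_lt h.1.1 h.1.2]⟩
      refine ⟨(β.1, w - β.1), fun _ => ⟨hR.mem_angles hP, rfl, by dsimp; omega, ?_⟩⟩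
      rw [hgx hR]
      dsimp; omega
    · exact ⟨0, fun h' => absurd h' h⟩
  choose ψ hψ using hψex
  have hcard : B.card = ∑ α ∈ angles n P, {β ∈ B | ψ β = α}.card :=
    Finset.card_eq_sum_card_fiberwise (fun β hβ => (hψ β hβ).1)
  have hfib : ∀ α ∈ angles n P, ({β ∈ B | ψ β = α}.card : ℤ) = g α := by
    intro α hα
    obtain ⟨s, x, t, hs⟩ := hP.exists_starAt hα
    have hgα := hgx hs
    have hl := hs.1.lt
    have hα' := mem_angles.1 hα
    have heq : {β ∈ B | ψ β = α} = {α.1} ×ˢ Finset.Ico α.2 (α.2 + g α) := by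
      ext β
      simp only [Finset.mem_filter, Finset.mem_product, Finset.mem_singleton, Finset.mem_Ico]
      constructor
      · rintro ⟨hβ, rfl⟩
        obtain ⟨-, h1, h2, h3⟩ := hψ β hβ
        exact ⟨h1.symm, h2, h3⟩
      · rintro ⟨h1, h2, h3⟩
        have hβ : β ∈ B := by
          simp only [hB, Finset.mem_product, Finset.mem_Ico]
          omega
        refine ⟨hβ, ?_⟩
        obtain ⟨h4, h5, h6, h7⟩ := hψ β hβ
        obtain ⟨s', x', t', hs'⟩ := hP.exists_starAt h4
        have hgψ := hgx hs'
        have e1 : (ψ β).1 = α.1 := by rw [h5, h1]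
        have hss := hs'.1
        rw [e1] at hss hgψ
        obtain ⟨-, h8, -⟩ := hss.unique hs.1 hP.free (j := α.1 + β.2) (by omega) (by omega)
          (by omega) (by omega)
        exact Prod.ext e1 (by omega)
    rw [heq, Finset.card_product, Finset.card_singleton, Int.card_Ico]
    omega
  have hBc : (B.card : ℤ) = n * (4 * n - 4) := by
    rw [hB, Finset.card_product, Int.card_Ico, Int.card_Ico]
    push_cast
    rw [Int.toNat_of_nonneg (by omega), Int.toNat_of_nonneg (by omega)]
    ring
  have hS : ∑ α ∈ angles n P, g α = n * (4 * n - 4) := by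
    rw [← hBc, hcard, Nat.cast_sum]
    exact (Finset.sum_congr rfl hfib).symm
  rw [hS] at hfive
  have : (4 * n) * ((angles n P).card : ℤ) = (4 * n) * (5 * (n - 1)) := by linarith
  exact mul_left_cancel₀ (by omega) this

open Classical in
/-- The orbits of relevant edges, represented by an endpoint in `[0, n)` and a length. -/
noncomputable def relevantEdges (n : ℤ) (P : ℤ → ℤ → Prop) : Finset (ℤ × ℤ) :=
  {p ∈ Finset.Ico 0 n ×ˢ Finset.Icc 3 (2 * n) | P p.1 (p.1 + p.2)}

theorem mem_relevantEdges {α : ℤ × ℤ} : α ∈ relevantEdges n P ↔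
    ((0 ≤ α.1 ∧ α.1 < n) ∧ 3 ≤ α.2 ∧ α.2 ≤ 2 * n) ∧ P α.1 (α.1 + α.2) := by
  classical
  simp [relevantEdges, Finset.mem_product]

/-- Let `d` be the number of orbits of diameters and `r` that of relevant non-diameters. Removing
the `n` angles that start with an edge of length `2` leaves `2r + d = 4n - 5`. This is odd and `d ≤
1`, so `d = 1` and `r + d = 2(n - 1)`. -/
theorem Tri.card_relevantEdges (hP : Tri n P) :
    ((relevantEdges n P).card : ℤ) = 2 * (n - 1) := by
  classical
  have hn := hP.pos
  have hA := hP.card_angles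
  rw [angles, card_filter_product_eq_sum] at hA
  rw [relevantEdges, card_filter_product_eq_sum]
  -- For `n = 1` there are no relevant lengths, and the splitting of the range `[2, 4n - 3]` used
  -- below is not available.
  rcases eq_or_lt_of_le (show 1 ≤ n from hn) with rfl | hn1
  · simp
  have hshort : lengthCount n P 2 = n.toNat := by
    rw [lengthCount, Finset.filter_true_of_mem, Int.card_Ico]
    · simp
    · intro v _
      exact hP.short (by omega) (by omega) (by omega)
  have hd := lengthCount_diameter_le hP.free hP.toPeriodic
  have e1 : Finset.Icc 2 (4 * n - 3) = insert 2 (Finset.Icc 3 (4 * n - 3)) := by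
    ext x; simp only [Finset.mem_Icc, Finset.mem_insert]; omega
  have e2 : Finset.Icc 3 (4 * n - 3) = Finset.Icc 3 (2 * n) ∪ Finset.Icc (2 * n + 1) (4 * n - 3) := by
    ext x; simp only [Finset.mem_Icc, Finset.mem_union]; omega
  have e3 : Finset.Icc 3 (2 * n) = insert (2 * n) (Finset.Icc 3 (2 * n - 1)) := by
    ext x; simp only [Finset.mem_Icc, Finset.mem_insert]; omega
  have e4 : ∑ ℓ ∈ Finset.Icc (2 * n + 1) (4 * n - 3), lengthCount n P ℓ =
      ∑ ℓ ∈ Finset.Icc 3 (2 * n - 1), lengthCount n P ℓ := by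
    refine Finset.sum_nbij' (fun ℓ => 4 * n - ℓ) (fun ℓ => 4 * n - ℓ) ?_ ?_ ?_ ?_ ?_
    · intro x; simp only [Finset.mem_Icc]; omega
    · intro x; simp only [Finset.mem_Icc]; omega
    · intro x _; ring
    · intro x _; ring
    · intro x _; rw [lengthCount_symm hP.toPeriodic hn]
  rw [e1, Finset.sum_insert (by simp), e2, Finset.sum_union, e4, e3, Finset.sum_insert (by simp),
    hshort] at hA
  · rw [e3, Finset.sum_insert (by simp)]
    push_cast at hA ⊢
    rw [Int.toNat_of_nonneg hn.le] at hA
    have := Nat.cast_nonneg (α := ℤ) (lengthCount n P (2 * n))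
    generalize (∑ x ∈ Finset.Icc 3 (2 * n - 1), (lengthCount n P x : ℤ)) = r at *
    omega
  · rw [Finset.disjoint_left]
    intro x; simp only [Finset.mem_Icc]; omega

end Multitriangulation

/-! ### The two stars at an edge, and existence of an exchange -/

namespace Multitriangulation

variable {n : ℤ} {P : ℤ → ℤ → Prop}

/-- Exchange the orbit of `[p, r]` for the orbit of `[x, y]`. -/
def Exch (n : ℤ) (P : ℤ → ℤ → Prop) (p r x y u v : ℤ) : Prop :=
  (P u v ∧ ¬ Orb n p r u v) ∨ Orb n x y u v

/-- The two stars `p, l, r, m₁, m₂` and `p, a, b, r, w` at the edge `[p, r]`, in the case where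
their common bisector is `[a, m₁]`. -/
structure StarPair (n : ℤ) (P : ℤ → ℤ → Prop) (p a b l r m₁ m₂ w : ℤ) : Prop where
  left : Star n P p l r m₁ m₂
  right : Star n P p a b r w
  hl : b ≤ l
  hw : m₂ ≤ w

/-- The two stars at an edge are in one of two mirror positions. -/
theorem Star.pair_cases {p a b l r m₁ m₂ w : ℤ} (hP : Tri n P) (hL : Star n P p l r m₁ m₂)
    (hM : Star n P p a b r w) : (b ≤ l ∧ m₂ ≤ w) ∨ (l ≤ a ∧ w ≤ m₁) := by
  have h1 := hL.lt
  have h2 := hM.lt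
  have hF := hP.free
  have hs : ∀ x y, P x y → P y (x + 4 * n) := fun x y h =>
    hP.move (hP.symm _ _ h) 0 4 (by ring) (by ring) (by norm_num)
  rcases lt_trichotomy l a with hla | hla | hla
  · by_contra hc
    exact hF p l a b m₁ w (by omega) hM.h02 hL.h13 hM.h14
  · by_contra hc
    subst hla
    exact (hM.rotate hP.toPeriodic).not_bisected hF (y := m₁) (by omega) (by omega) hL.h13
  · rcases lt_trichotomy w m₁ with hwm | hwm | hwm
    · exact (hF r w m₁ m₂ (a + 4 * n) (l + 4 * n) (by omega) hL.h24 (hs _ _ hM.h14)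
        (hs _ _ hL.h13)).elim
    · subst hwm
      exact ((((hL.rotate hP.toPeriodic).rotate hP.toPeriodic).rotate hP.toPeriodic).not_bisected
        hF (y := a + 4 * n) (by omega) (by omega) (hs _ _ hM.h14)).elim
    · left
      by_contra hc
      rcases lt_or_ge l b with h3 | h3
      · exact hF a l b r m₁ w (by omega) hM.h13 hL.h13 hM.h24
      · exact hF p a l m₁ w m₂ (by omega) hL.h03 hM.h14 hL.h14

namespace StarPair

variable {p a b l r m₁ m₂ w : ℤ}

/-- Reading the common edge from its other endpoint exchanges the roles of the two stars and of the
two ends of the bisector, which halves the later case analyses. -/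
theorem swap (h : StarPair n P p a b l r m₁ m₂ w) (hP : Periodic n P) :
    StarPair n P r m₁ m₂ w (p + 4 * n) (a + 4 * n) (b + 4 * n) (l + 4 * n) where
  left := ((h.right.rotate hP).rotate hP).rotate hP
  right := (h.left.rotate hP).rotate hP
  hl := h.hw
  hw := by linarith [h.hl]

theorem lt (h : StarPair n P p a b l r m₁ m₂ w) : p < a ∧ a < b ∧ b ≤ l ∧ l < r ∧ r < m₁ ∧
    m₁ < m₂ ∧ m₂ ≤ w ∧ w < p + 4 * n := by
  have h1 := h.left.lt
  have h2 := h.right.lt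
  have h3 := h.hl
  have h4 := h.hw
  omega

theorem not_mem (h : StarPair n P p a b l r m₁ m₂ w) (hF : Free (4 * n) P) : ¬ P a m₁ := by
  intro hc
  have hlt := h.lt
  exact hF p a l r m₁ m₂ (by omega) h.left.h02 hc h.left.h14

/-- The common bisector is blocked only by pairs containing the common edge. -/
theorem blocking_pair (h : StarPair n P p a b l r m₁ m₂ w) (hP : Tri n P) {c c' d d' : ℤ}
    (ho : a < c ∧ c < c' ∧ c' < m₁ ∧ m₁ < d ∧ d < d' ∧ d' < a + 4 * n) (hcd : P c d)
    (hcd' : P c' d') : c' = r ∧ d' = p + 4 * n := by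
  have hlt := h.lt
  have hF := hP.free
  have hs : ∀ x y, P x y → P (x + 4 * n) (y + 4 * n) := fun x y h =>
    hP.move h 4 4 (by ring) (by ring) (by norm_num)
  have hr : ∀ x y, P x y → P y (x + 4 * n) := fun x y h =>
    hP.move (hP.symm _ _ h) 0 4 (by ring) (by ring) (by norm_num)
  have e1 : r ≤ c' := by
    by_contra hc
    exact hF a c c' r d d' (by omega) h.right.h13 hcd hcd'
  have e2 : d ≤ w := by
    by_contra hc
    exact hF a c c' w d d' (by omega) h.right.h14 hcd hcd'
  have e3 : p + 4 * n ≤ d' := by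
    by_contra hc
    exact hF p c c' m₁ d d' (by omega) h.left.h03 hcd hcd'
  have e4 : c ≤ l := by
    by_contra hc
    exact hF l c c' m₁ d d' (by omega) h.left.h13 hcd hcd'
  have e5 : ¬ (r < c' ∧ p + 4 * n < d') := by
    rintro ⟨h1, h2⟩
    exact hF c r c' d (p + 4 * n) d' (by omega) hcd (hr _ _ h.left.h02) hcd'
  rcases eq_or_lt_of_le e1 with rfl | h1
  · refine ⟨rfl, ?_⟩
    by_contra hne
    exact (((h.right.rotate hP.toPeriodic).rotate hP.toPeriodic).rotate
      hP.toPeriodic).not_bisected hF (y := d') (by omega) (by omega) hcd'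
  · exfalso
    obtain rfl : d' = p + 4 * n := by omega
    exact h.left.not_bisected hF h1 (by omega) (hP.symm _ _
      (hP.move hcd' 0 (-4) (by ring) (by ring : p = p + 4 * n + (-4) * n) (by norm_num)))

/-- If `[a, a + n]` is in the orbit of the common edge then `m₁` is not close to `a`. -/
theorem not_orb_quarter (h : StarPair n P p a b l r m₁ m₂ w) (hP : Tri n P)
    (hm : m₁ < a + 2 * n) : ¬ Orb n p r a (a + n) := by
  intro ho
  have hn := hP.pos
  have hlt := h.lt
  obtain ⟨t, h1⟩ := ho.normal hn (by omega) (by omega) (by omega) (by omega)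
  have lo : ∀ c : ℤ, c * n < t * n → c < t := fun c => lt_of_mul_lt hn
  have hi : ∀ c : ℤ, t * n < c * n → t < c := fun c => lt_of_mul_lt hn
  rcases h1 with ⟨h1, h2⟩ | ⟨h1, h2⟩
  · have := lo 0 (by omega)
    have := hi 1 (by omega)
    omega
  · have := lo (-2) (by omega)
    have := hi 0 (by omega)
    obtain rfl : t = -1 := by omega
    exact (((h.right.rotate hP.toPeriodic).rotate hP.toPeriodic).rotate
      hP.toPeriodic).not_bisected hP.free (y := w + n) (by omega) (by omega)
      (hP.move h.right.h14 1 1 (by omega) (by omega) (by norm_num))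

/-- Some edge can be exchanged for the common edge. -/
theorem exists_exchange (h : StarPair n P p a b l r m₁ m₂ w) (hP : Tri n P) :
    ∃ x y, (x < y ∧ y < x + 4 * n) ∧ ¬ P x y ∧ Free (4 * n) (Exch n P p r x y) := by
  have hn := hP.pos
  have hlt := h.lt
  -- Every pair blocking the bisector contains the common edge, so removing its orbit unblocks the
  -- bisector.
  have hb : ¬ Blocked (4 * n) (fun u v => P u v ∧ ¬ Orb n p r u v) a m₁ := by
    rintro ⟨c, c', d, d', ho, hcd, hcd'⟩
    obtain ⟨rfl, rfl⟩ := h.blocking_pair hP ho hcd.1 hcd'.1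
    exact hcd'.2 ((Orb.refl n p c').swap.move 0 4 (by ring) (by ring) (by norm_num))
  rcases free_union_orb_or (hP.diff_orb p r) (hP.free.mono fun u v h => h.1) hn (by omega)
    (by omega) hb with hf | ⟨hm, h1, hf⟩ | ⟨hm, h1, hf⟩
  · exact ⟨a, m₁, by omega, h.not_mem hP.free, hf⟩
  -- The fallback edge is known to be missing only after the removal; it was missing from `P` too,
  -- since it is not a copy of the common edge.
  · exact ⟨a, a + n, by omega, fun hc => h1 ⟨hc, h.not_orb_quarter hP (by omega)⟩, hf⟩
  · refine ⟨m₁, m₁ + n, by omega, fun hc => h1 ⟨hc, fun ho => ?_⟩, hf⟩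
    exact (h.swap hP.toPeriodic).not_orb_quarter hP (by omega)
      (ho.trans ((Orb.refl n r (p + 4 * n)).swap.move (-4) 0 (by ring) (by ring) (by norm_num)))

/-- Otherwise a quarter turn of `[a, w]` would bisect the angle of the right star at `r`. The lemma
ensures that `[a, r]` survives the exchange. -/
theorem not_orb_right₁₃ (h : StarPair n P p a b l r m₁ m₂ w) (hP : Tri n P) :
    ¬ Orb n p r a r := by
  intro ho
  have hn := hP.pos
  have hlt := h.lt
  obtain ⟨t, h1⟩ := ho.normal hn (by omega) (by omega) (by omega) (by omega)
  have lo : ∀ c : ℤ, c * n < t * n → c < t := fun c => lt_of_mul_lt hn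
  have hi : ∀ c : ℤ, t * n < c * n → t < c := fun c => lt_of_mul_lt hn
  rcases h1 with ⟨h1, h2⟩ | ⟨h1, h2⟩
  · omega
  · have := lo (-2) (by omega)
    have := hi 0 (by omega)
    obtain rfl : t = -1 := by omega
    exact (((h.right.rotate hP.toPeriodic).rotate hP.toPeriodic).rotate
      hP.toPeriodic).not_bisected hP.free (y := w + n) (by omega) (by omega)
      (hP.move h.right.h14 1 1 (by omega) (by omega) (by norm_num))

/-- Otherwise a quarter turn of `[b, w]` would bisect the angle of the right star at `p`. -/
theorem not_orb_right₀₂ (h : StarPair n P p a b l r m₁ m₂ w) (hP : Tri n P) :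
    ¬ Orb n p r p b := by
  intro ho
  have hn := hP.pos
  have hlt := h.lt
  obtain ⟨t, h1⟩ := ho.normal hn (by omega) (by omega) (by omega) (by omega)
  have lo : ∀ c : ℤ, c * n < t * n → c < t := fun c => lt_of_mul_lt hn
  have hi : ∀ c : ℤ, t * n < c * n → t < c := fun c => lt_of_mul_lt hn
  rcases h1 with ⟨h1, h2⟩ | ⟨h1, h2⟩
  · omega
  · have := lo (-4) (by omega)
    have := hi (-2) (by omega)
    obtain rfl : t = -3 := by omega
    exact h.right.not_bisected hP.free (y := w - n) (by omega) (by omega)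
      (hP.move h.right.h24 (-1) (-1) (by omega) (by omega) (by norm_num))

/-- The stars `p, l, r, m₁, m₂` and `p, a, b, r, w` are rotations of each other by `n`. -/
def Linked (n p a b l r m₁ m₂ w : ℤ) : Prop :=
  l = r - n ∧ m₁ = p + 3 * n ∧ a = m₂ - 3 * n ∧ b = p + n ∧ w = r + n

/-- If the left star has a second copy of the common edge, rotating that copy onto `[p, r]` turns
the left star into a star at `[p, r]`. It cannot be the left star again, so it is the right one. -/
theorem linked_of_orb₁₃ (h : StarPair n P p a b l r m₁ m₂ w) (hP : Tri n P)
    (ho : Orb n p r l m₁) : Linked n p a b l r m₁ m₂ w := by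
  have hn := hP.pos
  have hlt := h.lt
  obtain ⟨t, h1⟩ := ho.normal hn (by omega) (by omega) (by omega) (by omega)
  have lo : ∀ c : ℤ, c * n < t * n → c < t := fun c => lt_of_mul_lt hn
  have hi : ∀ c : ℤ, t * n < c * n → t < c := fun c => lt_of_mul_lt hn
  rcases h1 with ⟨h1, h2⟩ | ⟨h1, h2⟩
  · have := lo 0 (by omega)
    have := hi 2 (by omega)
    obtain rfl : t = 1 := by omega
    have hs := (h.left.rot hP.toPeriodic (-1)).rotate hP.toPeriodic
    rw [show l + -1 * n = p by omega] at hs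
    have := hs.lt
    have := hs.unique h.left hP.free (j := r) (by omega) (by omega) (by omega) (by omega)
    omega
  · have := lo (-2) (by omega)
    have := hi 0 (by omega)
    obtain rfl : t = -1 := by omega
    have hs := (((h.left.rot hP.toPeriodic (-3)).rotate hP.toPeriodic).rotate
      hP.toPeriodic).rotate hP.toPeriodic
    rw [show m₁ + -3 * n = p by omega] at hs
    have := hs.lt
    have := hs.unique h.right hP.free (j := r - 1) (by omega) (by omega) (by omega) (by omega)
    exact ⟨by omega, by omega, by omega, by omega, by omega⟩

/-- The same rotation argument; here the stars are linked in the position seen from `r`. -/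
theorem linked_of_orb₁₄ (h : StarPair n P p a b l r m₁ m₂ w) (hP : Tri n P)
    (ho : Orb n p r l m₂) :
    Linked n r m₁ m₂ w (p + 4 * n) (a + 4 * n) (b + 4 * n) (l + 4 * n) := by
  have hn := hP.pos
  have hlt := h.lt
  obtain ⟨t, h1⟩ := ho.normal hn (by omega) (by omega) (by omega) (by omega)
  have lo : ∀ c : ℤ, c * n < t * n → c < t := fun c => lt_of_mul_lt hn
  have hi : ∀ c : ℤ, t * n < c * n → t < c := fun c => lt_of_mul_lt hn
  rcases h1 with ⟨h1, h2⟩ | ⟨h1, h2⟩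
  · have := lo 0 (by omega)
    have := hi 2 (by omega)
    obtain rfl : t = 1 := by omega
    have hs := (h.left.rot hP.toPeriodic (-1)).rotate hP.toPeriodic
    rw [show l + -1 * n = p by omega] at hs
    have := hs.lt
    have := hs.unique h.right hP.free (j := r - 1) (by omega) (by omega) (by omega) (by omega)
    exact ⟨by omega, by omega, by omega, by omega, by omega⟩
  · have := lo (-2) (by omega)
    have := hi 0 (by omega)
    obtain rfl : t = -1 := by omega
    have hs := ((((h.left.rot hP.toPeriodic (-3)).rotate hP.toPeriodic).rotate
      hP.toPeriodic).rotate hP.toPeriodic).rotate hP.toPeriodic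
    rw [show m₂ + -3 * n = p by omega] at hs
    have := hs.lt
    have := hs.unique h.left hP.free (j := r) (by omega) (by omega) (by omega) (by omega)
    omega

end StarPair

end Multitriangulation

/-! ### Uniqueness of the exchange -/

namespace Multitriangulation

variable {n : ℤ} {P : ℤ → ℤ → Prop}

theorem Exch.old {p r x y u v : ℤ} (h : P u v) (ho : ¬ Orb n p r u v) : Exch n P p r x y u v :=
  Or.inl ⟨h, ho⟩

theorem Exch.congr_orb {p r p' r' x y x' y' u v : ℤ} (h : Exch n P p r x y u v)
    (hp : Orb n p r p' r') (hx : Orb n x' y' x y) : Exch n P p' r' x' y' u v :=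
  Or.imp (And.imp_right (mt fun ho => ho.trans hp)) (fun ho => ho.trans hx) h

theorem Orb.turn (n p r : ℤ) : Orb n p r r (p + 4 * n) :=
  (Orb.refl n p r).swap.move 0 4 (by ring) (by ring) (by norm_num)

theorem Orb.turn' (n p r : ℤ) : Orb n r (p + 4 * n) p r := (Orb.turn n p r).comm

namespace StarPair

variable {p a b l r m₁ m₂ w : ℤ}

/-- An edge exchangeable for the common edge bisects a star containing a copy of this edge. -/
theorem bisects (h : StarPair n P p a b l r m₁ m₂ w) (hP : Tri n P) {x y : ℤ} (hxy : x < y)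
    (hyx : y < x + 4 * n) (hno : ¬ P x y) (hf : Free (4 * n) (Exch n P p r x y)) :
    ∃ t : ℤ, (x + 4 * n = m₂ + t * n ∧ l + t * n < y ∧ y < r + t * n) ∨
      (x + 4 * n = m₁ + t * n ∧ p + t * n < y ∧ y < l + t * n) ∨
      (x = b + t * n ∧ w + t * n < y ∧ y < p + 4 * n + t * n) ∨
      (x = a + t * n ∧ r + t * n < y ∧ y < w + t * n) := by
  have hn := hP.pos
  have hPp := hP.toPeriodic
  have hlt := h.lt
  have h1 : x + 2 < y := by
    by_contra hc
    exact hno (hP.short hxy (by omega) hyx)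
  have h2 : y < x + 4 * n - 2 := by
    by_contra hc
    exact hno (hP.short' (by omega) hyx hxy)
  -- The star whose angle at `x` contains `y`. The new edge forms a `3`-crossing with the opposite
  -- edges `[s, u]` and `[c, d]`, so one of them must have been removed.
  obtain ⟨s, c, u, d, hst, hc, hu⟩ := hP.exists_star h1.le h2
  have hcy : c < y := by
    refine lt_of_le_of_ne hc ?_
    rintro rfl
    exact hno hst.h02
  have hl := hst.lt
  have hor : Orb n p r s u ∨ Orb n p r c d := by
    by_contra hcon
    push Not at hcon
    exact hf x s c y u d (by omega) (Or.inr (Orb.refl n x y)) (Exch.old hst.h13 hcon.1)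
      (Exch.old hst.h24 hcon.2)
  -- By uniqueness of stars, one containing a copy of the common edge is a copy of the left star
  -- (`hL'`) or of the right star (`hM'`).
  have hL' : ∀ t : ℤ, ∀ y₁ y₂ y₃ y₄, Star n P (p + t * n) y₁ y₂ y₃ y₄ → y₂ = r + t * n →
      y₁ = l + t * n ∧ y₃ = m₁ + t * n ∧ y₄ = m₂ + t * n := by
    intro t y₁ y₂ y₃ y₄ hs he
    have := hs.lt
    have := hs.unique (h.left.rot hPp t) hP.free (j := r + t * n) (by omega) (by omega) (by omega)
      (by omega)
    omega
  have hM' : ∀ t : ℤ, ∀ y₁ y₂ y₃ y₄, Star n P (r + t * n) y₁ y₂ y₃ y₄ →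
      y₂ = p + t * n + 4 * n →
      y₁ = w + t * n ∧ y₃ = a + t * n + 4 * n ∧ y₄ = b + t * n + 4 * n := by
    intro t y₁ y₂ y₃ y₄ hs he
    have := hs.lt
    have := hs.unique ((((h.right.rotate hPp).rotate hPp).rotate hPp).rot hPp t) hP.free
      (j := p + t * n + 4 * n) (by omega) (by omega) (by omega) (by omega)
    omega
  rcases hor with ho | ho
  · obtain ⟨t, ⟨e1, e2⟩ | ⟨e1, e2⟩⟩ := ho.normal hn (by omega) (by omega) (by omega) (by omega)
    · subst e1
      have := hL' t _ _ _ _ (hst.rotate hPp) e2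
      exact ⟨t, Or.inl (by omega)⟩
    · subst e1
      have := hM' t _ _ _ _ (hst.rotate hPp) e2
      exact ⟨t, Or.inr (Or.inr (Or.inl (by omega)))⟩
  · obtain ⟨t, ⟨e1, e2⟩ | ⟨e1, e2⟩⟩ := ho.normal hn (by omega) (by omega) (by omega) (by omega)
    · subst e1
      have := hL' t _ _ _ _ ((hst.rotate hPp).rotate hPp) e2
      exact ⟨t, Or.inr (Or.inl (by omega))⟩
    · subst e1
      have := hM' t _ _ _ _ ((hst.rotate hPp).rotate hPp) e2
      exact ⟨t, Or.inr (Or.inr (Or.inr (by omega)))⟩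

/-- A bisector `[z, m₂]` of the left star forms a `3`-crossing with `[a, r]` and `[l, m₁]`, both of
which survive. -/
theorem false_of_bisects₄ (h : StarPair n P p a b l r m₁ m₂ w) (hP : Tri n P) {x y z : ℤ}
    (hf : Free (4 * n) (Exch n P p r x y)) (ho : Orb n x y z m₂) (h1 : l < z) (h2 : z < r)
    (hc : ¬ Orb n p r l m₁) : False := by
  have hlt := h.lt
  exact hf a l z r m₁ m₂ (by omega) (Exch.old h.right.h13 (h.not_orb_right₁₃ hP))
    (Exch.old h.left.h13 hc) (Or.inr ho)

/-- A bisector `[z, m₁]` with `z < a` forms a `3`-crossing with `[p, b]` and `[a, w]`; with `z > a`,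
it does so with `[a, r]` and `[l, m₂]`. -/
theorem eq_of_bisects₃ (h : StarPair n P p a b l r m₁ m₂ w) (hP : Tri n P) {x y z : ℤ}
    (hf : Free (4 * n) (Exch n P p r x y)) (ho : Orb n x y z m₁) (h1 : p < z) (h2 : z < l)
    (hc : ¬ Orb n p r l m₂) (hc' : ¬ Orb n p r a w) : z = a := by
  have hlt := h.lt
  by_contra hne
  rcases lt_or_gt_of_ne hne with hza | hza
  · exact hf p z a b m₁ w (by omega) (Exch.old h.right.h02 (h.not_orb_right₀₂ hP)) (Or.inr ho)
      (Exch.old h.right.h14 hc')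
  · exact hf a z l r m₁ m₂ (by omega) (Exch.old h.right.h13 (h.not_orb_right₁₃ hP)) (Or.inr ho)
      (Exch.old h.left.h14 hc)

/-- When the stars are linked, `[l, m₁]` is removed as well and `false_of_bisects₄` does not apply.
However, `m₂` and `a` now agree modulo `n`, as do `m₁`, `b` and `p`. Applying `bisects` from both
ends puts each endpoint of the new edge in one of these two classes, which leaves finitely many
positions. -/
theorem unique_of_linked (h : StarPair n P p a b l r m₁ m₂ w) (hP : Tri n P)
    (hk : Linked n p a b l r m₁ m₂ w) {x y : ℤ} (hxy : x < y)
    (hyx : y < x + 4 * n) (hno : ¬ P x y) (hf : Free (4 * n) (Exch n P p r x y)) :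
    Orb n a m₁ x y := by
  have hn := hP.pos
  have hPp := hP.toPeriodic
  have hlt := h.lt
  obtain ⟨e1, e2, e3, e4, e5⟩ := hk
  -- If the common edge were a diameter, `[a, r]` would form a `3`-crossing with two copies of `[r,
  -- m₂]`.
  have hr : p + 2 * n < r := by
    refine lt_of_le_of_ne (by omega) fun he => ?_
    exact hP.free p a (p + n) (a + n) r (a + 2 * n) (by omega)
      (hP.move h.left.h24 (-2) (-2) (by omega) (by omega) (by norm_num)) h.right.h13
      (hP.move h.left.h24 (-1) (-1) (by omega) (by omega) (by norm_num))
  have c1 : ¬ Orb n p r l m₂ := fun ho => h.not_orb_right₁₃ hP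
    (ho.swap.move (-3) 1 (by omega) (by omega) (by norm_num))
  have c2 : ¬ Orb n p r a w := by
    intro ho
    obtain ⟨t, h1⟩ := ho.normal hn (by omega) (by omega) (by omega) (by omega)
    have lo : ∀ c : ℤ, c * n < t * n → c < t := fun c => lt_of_mul_lt hn
    have hi : ∀ c : ℤ, t * n < c * n → t < c := fun c => lt_of_mul_lt hn
    rcases h1 with ⟨h1, h2⟩ | ⟨h1, h2⟩
    · have := lo 0 (by omega)
      have := hi 1 (by omega)
      omega
    · have := lo (-1) (by omega)
      have := hi 0 (by omega)
      omega
  have c3 : ¬ Orb n p r w (a + 4 * n) := fun ho =>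
    c2 (ho.swap.move (-4) 0 (by ring) (by ring) (by norm_num))
  have hold : ∀ {u v u' v' : ℤ} (j k : ℤ), P u v → ¬ Orb n p r u v → u' = u + j * n →
      v' = v + k * n → (4 : ℤ) ∣ k - j → Exch n P p r x y u' v' := by
    intro u v u' v' j k h1 h2 h3 h4 h5
    refine Exch.old (hP.move h1 j k h3 h4 h5) fun ho => h2 ?_
    exact ho.move (-j) (-k) (by rw [h3]; ring) (by rw [h4]; ring) (by omega)
  have h02 := h.not_orb_right₀₂ hP
  have h13 := h.not_orb_right₁₃ hP
  -- the other endpoint of the edge lies on one of the stars as well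
  obtain ⟨s, hs⟩ := h.bisects hP (x := y) (y := x + 4 * n) hyx (by omega)
    (fun hc => hno (hP.symm _ _ (hP.move hc 0 (-4) (by ring) (by ring) (by norm_num))))
    (hf.mono fun u v he => he.congr_orb (Orb.refl n p r) (Orb.turn n x y))
  obtain ⟨t, ht⟩ := h.bisects hP hxy hyx hno hf
  have ho : Orb n x y (y - t * n) (x + 4 * n - t * n) :=
    (Orb.refl n x y).swap.move (-t) (4 - t) (by ring) (by ring) (by ring_nf; norm_num)
  have hst : s * n = t * n + (s - t) * n := by ring
  have hk : ∃ k : ℤ, y = p + k * n + t * n ∨ y = a + k * n + t * n := by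
    rcases hs with hs | hs | hs | hs
    · exact ⟨s - t - 1, Or.inr (by linarith [hs.1])⟩
    · exact ⟨s - t - 1, Or.inl (by linarith [hs.1])⟩
    · exact ⟨s - t + 1, Or.inl (by linarith [hs.1])⟩
    · exact ⟨s - t, Or.inr (by linarith [hs.1])⟩
  clear hs hst
  obtain ⟨k, hk⟩ := hk
  have lo : ∀ c : ℤ, c * n < k * n → c < k := fun c => lt_of_mul_lt hn
  have hi : ∀ c : ℤ, k * n < c * n → k < c := fun c => lt_of_mul_lt hn
  rcases ht with ⟨h1, h2, h3⟩ | ⟨h1, h2, h3⟩ | ⟨h1, h2, h3⟩ | ⟨h1, h2, h3⟩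
  · rcases hk with hk | hk
    · have := lo 1 (by omega)
      have := hi 3 (by omega)
      obtain rfl : k = 2 := by omega
      exact (Orb.refl n a m₁).move (t - 1) (t - 1) (by linarith) (by linarith) (by simp)
    · have := lo 0 (by omega)
      have := hi 3 (by omega)
      rcases (show k = 1 ∨ k = 2 by omega) with rfl | rfl
      · exact (hf (a + n) (p + 3 * n) (r + n) (a + 3 * n) (p + 4 * n) (a + 4 * n) (by omega)
          (Or.inr (ho.move 0 0 (by omega) (by omega) (by norm_num)))
          (hold 3 3 h.right.h02 h02 (by omega) (by omega) (by norm_num))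
          (hold 0 4 (hP.symm _ _ h.right.h14) (fun ho => c2 ho.swap) (by omega) (by omega)
            (by norm_num))).elim
      · exact (hf a (p + 2 * n) (a + 2 * n) r (p + 3 * n) (a + 3 * n) (by omega)
          (hold 0 0 h.right.h13 h13 (by omega) (by omega) (by norm_num))
          (hold 2 2 h.right.h02 h02 (by omega) (by omega) (by norm_num))
          (Or.inr (ho.move 0 0 (by omega) (by omega) (by norm_num)))).elim
  · have h4 : x + 4 * n - t * n = m₁ := by omega
    rw [h4] at ho
    rw [h.eq_of_bisects₃ hP hf ho (by omega) (by omega) c1 c2] at ho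
    exact ho.comm
  · have h4 : x + 4 * n - t * n = b + 4 * n := by omega
    rw [h4] at ho
    exact ((h.swap hPp).false_of_bisects₄ hP
      (hf.mono fun u v he => he.congr_orb (Orb.turn' n p r) (Orb.refl n x y)) ho (by omega)
      (by omega) (fun hc => c3 (hc.trans (Orb.turn n p r)))).elim
  · rcases hk with hk | hk
    · have := lo 2 (by omega)
      have := hi 4 (by omega)
      obtain rfl : k = 3 := by omega
      exact (Orb.refl n a m₁).move t t (by linarith) (by linarith) (by simp)
    · have := lo 1 (by omega)
      have := hi 4 (by omega)
      rcases (show k = 2 ∨ k = 3 by omega) with rfl | rfl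
      · exact (hf a (p + 2 * n) r (a + 2 * n) (p + 3 * n) m₂ (by omega)
          (Or.inr (ho.swap.move (-4) 0 (by omega) (by omega) (by norm_num)))
          (hold 2 2 h.right.h02 h02 (by omega) (by omega) (by norm_num))
          (hold (-1) 3 (hP.symm _ _ h.right.h14) (fun ho => c2 ho.swap) (by omega) (by omega)
            (by norm_num))).elim
      · exact (hf (a + n) (p + 3 * n) (a + 3 * n) (r + n) (p + 4 * n) (a + 4 * n) (by omega)
          (hold 1 1 h.right.h13 h13 (by omega) (by omega) (by norm_num))
          (hold 3 3 h.right.h02 h02 (by omega) (by omega) (by norm_num))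
          (Or.inr (ho.move 0 0 (by omega) (by omega) (by norm_num)))).elim

/-- Only copies of the common bisector can be exchanged for the common edge. -/
theorem unique_exchange (h : StarPair n P p a b l r m₁ m₂ w) (hP : Tri n P) {x y : ℤ}
    (hxy : x < y) (hyx : y < x + 4 * n) (hno : ¬ P x y)
    (hf : Free (4 * n) (Exch n P p r x y)) : Orb n a m₁ x y := by
  have hn := hP.pos
  have hPp := hP.toPeriodic
  have hlt := h.lt
  have hf' : Free (4 * n) (Exch n P r (p + 4 * n) x y) :=
    hf.mono fun u v he => he.congr_orb (Orb.turn' n p r) (Orb.refl n x y)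
  have hsw := h.swap hPp
  have hlink : Linked n r m₁ m₂ w (p + 4 * n) (a + 4 * n) (b + 4 * n) (l + 4 * n) →
      Orb n a m₁ x y := fun hk =>
    (hsw.unique_of_linked hP hk hxy hyx hno hf').trans (Orb.turn n a m₁)
  -- The surviving edges needed below could fail to survive only by being copies of the common edge;
  -- then the stars are linked, directly or as seen from `r`.
  by_cases c1 : Orb n p r l m₁
  · exact h.unique_of_linked hP (h.linked_of_orb₁₃ hP c1) hxy hyx hno hf
  by_cases c2 : Orb n p r l m₂
  · exact hlink (h.linked_of_orb₁₄ hP c2)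
  by_cases c3 : Orb n p r w (a + 4 * n)
  · exact hlink (hsw.linked_of_orb₁₃ hP (c3.trans (Orb.turn' n p r)))
  by_cases c4 : Orb n p r w (b + 4 * n)
  · obtain ⟨e1, e2, e3, e4, e5⟩ := hsw.linked_of_orb₁₄ hP (c4.trans (Orb.turn' n p r))
    exact h.unique_of_linked hP ⟨by omega, by omega, by omega, by omega, by omega⟩ hxy hyx hno hf
  obtain ⟨t, ht⟩ := h.bisects hP hxy hyx hno hf
  have ho : Orb n x y (y - t * n) (x + 4 * n - t * n) :=
    (Orb.refl n x y).swap.move (-t) (4 - t) (by ring) (by ring) (by ring_nf; norm_num)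
  have c5 : ¬ Orb n p r a w := fun hc =>
    c3 (hc.swap.move 0 4 (by ring) (by ring) (by norm_num))
  have c6 : ¬ Orb n p r m₁ (l + 4 * n) := fun hc =>
    c1 (hc.swap.move (-4) 0 (by ring) (by ring) (by norm_num))
  -- An angle bisected at a copy of `m₂` or `b` gives a `3`-crossing; at a copy of `m₁` or `a`, the
  -- edge is a copy of the common bisector.
  rcases ht with ⟨h1, h2, h3⟩ | ⟨h1, h2, h3⟩ | ⟨h1, h2, h3⟩ | ⟨h1, h2, h3⟩
  · rw [show x + 4 * n - t * n = m₂ by omega] at ho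
    exact (h.false_of_bisects₄ hP hf ho (by omega) (by omega) c1).elim
  · rw [show x + 4 * n - t * n = m₁ by omega] at ho
    rw [h.eq_of_bisects₃ hP hf ho (by omega) (by omega) c2 c5] at ho
    exact ho.comm
  · rw [show x + 4 * n - t * n = b + 4 * n by omega] at ho
    exact (hsw.false_of_bisects₄ hP hf' ho (by omega) (by omega)
      (fun hc => c3 (hc.trans (Orb.turn n p r)))).elim
  · rw [show x + 4 * n - t * n = a + 4 * n by omega] at ho
    rw [hsw.eq_of_bisects₃ hP hf' ho (by omega) (by omega)
      (fun hc => c4 (hc.trans (Orb.turn n p r))) (fun hc => c6 (hc.trans (Orb.turn n p r)))] at ho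
    exact ho.comm.trans (Orb.turn n a m₁)

end StarPair

theorem Free.neg {N : ℤ} (h : Free N P) (hs : ∀ u v, P u v → P v u) :
    Free N (fun u v => P (-u) (-v)) := fun a₁ a₂ a₃ b₁ b₂ b₃ ho h1 h2 h3 =>
  h (-b₃) (-b₂) (-b₁) (-a₃) (-a₂) (-a₁) (by omega) (hs _ _ h3) (hs _ _ h2) (hs _ _ h1)

theorem Orb.neg {p r u v : ℤ} (h : Orb n p r u v) : Orb n (-p) (-r) (-u) (-v) := by
  obtain ⟨j, k, h4, h | h⟩ := h
  · exact ⟨-j, -k, by omega, Or.inl ⟨by rw [h.1]; ring, by rw [h.2]; ring⟩⟩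
  · exact ⟨-j, -k, by omega, Or.inr ⟨by rw [h.1]; ring, by rw [h.2]; ring⟩⟩

theorem orb_neg_iff {p r u v : ℤ} : Orb n (-p) (-r) (-u) (-v) ↔ Orb n p r u v :=
  ⟨fun h => by simpa using h.neg, Orb.neg⟩

theorem Tri.neg (h : Tri n P) : Tri n (fun u v => P (-u) (-v)) where
  symm u v := h.symm _ _
  add_right u v := by
    rw [← h.add_right (-u) (-(v + 4 * n))]
    ring_nf
  rot u v := by
    rw [← h.rot (-(u + n)) (-(v + n))]
    ring_nf
  irrefl u := h.irrefl _
  pos := h.pos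
  free := h.free.neg h.symm
  blocked u v huv hvu hno := by
    obtain ⟨a, a', b, b', ho, h1, h2⟩ := h.blocked (-v) (-u) (by omega) (by omega)
      (fun hc => hno (h.symm _ _ hc))
    refine ⟨-a', -a, 4 * n - b', 4 * n - b, by omega, ?_, ?_⟩
    · exact h.move h2 0 (-4) (by ring) (by ring) (by norm_num)
    · exact h.move h1 0 (-4) (by ring) (by ring) (by norm_num)

theorem Exch.symm (hP : Periodic n P) {p r x y u v : ℤ} (h : Exch n P p r x y u v) :
    Exch n P p r x y v u :=
  Or.imp (And.imp (hP.symm _ _) (mt Orb.swap)) Orb.swap h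

/-- Every relevant edge can be exchanged for exactly one other orbit of edges. -/
theorem Tri.exists_unique_exchange (hP : Tri n P) {p r : ℤ} (h1 : p + 3 ≤ r)
    (h2 : r ≤ p + 4 * n - 3) (hpr : P p r) :
    ∃ a m, (a < m ∧ m < a + 4 * n) ∧ ¬ P a m ∧ Free (4 * n) (Exch n P p r a m) ∧
      ∀ x y, x < y → y < x + 4 * n → ¬ P x y → Free (4 * n) (Exch n P p r x y) →
        Orb n a m x y := by
  have of_pair : ∀ {Q : ℤ → ℤ → Prop} {p a b l r m₁ m₂ w : ℤ}, Tri n Q →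
      StarPair n Q p a b l r m₁ m₂ w → ∃ a m, (a < m ∧ m < a + 4 * n) ∧ ¬ Q a m ∧
      Free (4 * n) (Exch n Q p r a m) ∧ ∀ x y, x < y → y < x + 4 * n → ¬ Q x y →
        Free (4 * n) (Exch n Q p r x y) → Orb n a m x y := by
    intro Q p a b l r m₁ m₂ w hQ h
    obtain ⟨x, y, hxy, hno, hf⟩ := h.exists_exchange hQ
    refine ⟨x, y, hxy, hno, hf, fun x' y' h1 h2 h3 h4 => ?_⟩
    exact (h.unique_exchange hQ h1 h2 h3 h4).trans (h.unique_exchange hQ hxy.1 hxy.2 hno hf).comm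
  obtain ⟨l, m₁, m₂, hL⟩ := hP.exists_star_of_edge (by omega) h2 hpr
  obtain ⟨a, b, w, hM⟩ := hP.exists_star_of_edge' h1 (by omega) hpr
  rcases hL.pair_cases hP hM with ⟨h3, h4⟩ | ⟨h3, h4⟩
  · exact of_pair hP ⟨hL, hM, h3, h4⟩
  · have hl := hL.lt
    have hm := hM.lt
    have hs : ∀ {u v u' v' : ℤ}, P u v → u' = v → v' = u - 4 * n → P u' v' := fun h e1 e2 =>
      hP.move (hP.symm _ _ h) 0 (-4) (by rw [e1]; ring) (by rw [e2]; ring) (by norm_num)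
    -- The other position of the two stars becomes a `StarPair` under the reflection `u ↦ -u`, with
    -- endpoints shifted by a full turn where the cyclic order requires it.
    have hst : StarPair n (fun u v => P (-u) (-v)) (-r) (-b) (-a) (-l) (-p) (4 * n - m₂)
        (4 * n - m₁) (4 * n - w) := by
      refine ⟨⟨by omega, ?_, ?_, ?_, ?_, ?_⟩, ⟨by omega, ?_, ?_, ?_, ?_, ?_⟩, by omega, by omega⟩
      · simpa using hP.symm _ _ hL.h02
      · exact hP.move hL.h24 0 (-4) (by ring) (by ring) (by norm_num)
      · exact hP.move hL.h14 0 (-4) (by ring) (by ring) (by norm_num)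
      · exact hP.move hL.h13 0 (-4) (by ring) (by ring) (by norm_num)
      · exact hP.move hL.h03 0 (-4) (by ring) (by ring) (by norm_num)
      · simpa using hP.symm _ _ hM.h13
      · simpa using hP.symm _ _ hM.h03
      · simpa using hP.symm _ _ hM.h02
      · exact hP.move hM.h24 0 (-4) (by ring) (by ring) (by norm_num)
      · exact hP.move hM.h14 0 (-4) (by ring) (by ring) (by norm_num)
    obtain ⟨x, y, hxy, hno, hf, huniq⟩ := of_pair hP.neg hst
    have hex : ∀ x y u v, Exch n (fun u v => P (-u) (-v)) (-r) (-p) x y u v ↔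
        Exch n P p r (-y) (-x) (-u) (-v) := by
      intro x y u v
      have e1 : Orb n (-r) (-p) u v ↔ Orb n p r (-u) (-v) := by
        rw [← orb_neg_iff, neg_neg, neg_neg]
        exact ⟨fun h => h.trans (Orb.refl n p r).swap, fun h => h.trans (Orb.refl n r p).swap⟩
      have e2 : Orb n x y u v ↔ Orb n (-y) (-x) (-u) (-v) := by
        rw [orb_neg_iff]
        exact ⟨fun h => h.trans (Orb.refl n y x).swap, fun h => h.trans (Orb.refl n x y).swap⟩
      rw [Exch, Exch, e1, e2]
    refine ⟨-y, -x, by omega, fun hc => hno (hP.symm _ _ hc), ?_, ?_⟩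
    · refine (hf.neg fun u v => Exch.symm hP.neg.toPeriodic).mono fun u v h => ?_
      rw [hex]
      simpa using h
    · intro x' y' h5 h6 h7 h8
      have h9 := huniq (-y') (-x') (by omega) (by omega)
        (fun hc => h7 (hP.symm _ _ (by simpa using hc))) ?_
      · rw [← orb_neg_iff, neg_neg, neg_neg]
        exact (h9.swap).trans (Orb.refl n x y) |>.trans (Orb.refl n y x).swap
      · refine (h8.neg fun u v => Exch.symm hP.toPeriodic).mono fun u v h => ?_
        rw [hex] at h
        simpa using h

end Multitriangulation

/-! ### Crossings of edges in terms of integer labels -/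

namespace Multitriangulation

section Crossing

variable {V : Type*} [CircularOrder V]

theorem Edge.Crosses.symm {e f : Edge V} (h : e.Crosses f) : f.Crosses e := by
  obtain ⟨a, b, c, d, he, hf, h1, h2⟩ := h
  refine ⟨c, d, b, a, hf, by rw [he, Sym2.eq_swap], ?_, ?_⟩
  · exact ((h2.cyclic_left.trans_left h1).cyclic_left)
  · exact ((h1.cyclic_left.trans_left h2).cyclic_left)

theorem Edge.Crosses.ne {e f : Edge V} (h : e.Crosses f) : e ≠ f := by
  rintro rfl
  obtain ⟨a, b, c, d, he, hf, h1, h2⟩ := h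
  rw [he, Sym2.eq_iff] at hf
  rcases hf with ⟨rfl, rfl⟩ | ⟨rfl, rfl⟩
  · exact (sbtw_irrefl_left h1)
  · exact (sbtw_irrefl_right h1)

theorem crossingFree_three_iff {T : Set (Edge V)} : CrossingFree 3 T ↔
    ∀ e ∈ T, ∀ f ∈ T, ∀ g ∈ T, e.Crosses f → e.Crosses g → f.Crosses g → False := by
  classical
  constructor
  · intro h e he f hf g hg h1 h2 h3
    refine h {e, f, g} ?_ ⟨Finset.card_eq_three.2 ⟨e, f, g, h1.ne, h2.ne, h3.ne, rfl⟩, ?_⟩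
    · simp [Set.insert_subset_iff, he, hf, hg]
    · intro x hx y hy hxy
      simp only [Finset.coe_insert, Finset.coe_singleton, Set.mem_insert_iff,
        Set.mem_singleton_iff] at hx hy
      rcases hx with rfl | rfl | rfl <;> rcases hy with rfl | rfl | rfl <;>
        first
        | exact absurd rfl hxy
        | assumption
        | exact Edge.Crosses.symm ‹_›
  · rintro h F hF ⟨hc, hp⟩
    obtain ⟨e, f, g, h1, h2, h3, rfl⟩ := Finset.card_eq_three.1 hc
    simp only [Finset.coe_insert, Finset.coe_singleton, Set.insert_subset_iff,
      Set.singleton_subset_iff] at hF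
    exact h e hF.1 f hF.2.1 g hF.2.2 (hp (by simp) (by simp) h1) (hp (by simp) (by simp) h2)
      (hp (by simp) (by simp) h3)

end Crossing

section ZModOrder

variable {N : ℕ} [NeZero N]

theorem zmod_sbtw_iff {x y z : ZMod N} : sbtw x y z ↔ x.val < y.val ∧ y.val < z.val ∨
    y.val < z.val ∧ z.val < x.val ∨ z.val < x.val ∧ x.val < y.val := by
  obtain _ | N := N
  · exact absurd rfl (NeZero.ne 0)
  · exact Fin.sbtw_iff

theorem exists_val_eq (a : ℤ) : ∃ q : ℤ, a = ((a : ZMod N).val : ℤ) + N * q :=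
  ⟨a / N, by rw [ZMod.val_intCast]; exact (Int.emod_add_mul_ediv a N).symm⟩

/-- Labels less than one turn apart lie in the same period or in consecutive ones; stating this
through the products `N * q` keeps the later comparisons linear. -/
theorem quotient_cases {N r s q q' : ℤ} (hr : 0 ≤ r) (hrN : r < N) (hs : 0 ≤ s) (hsN : s < N)
    (h1 : r + N * q < s + N * q') (h2 : s + N * q' < r + N * q + N) :
    N * q' = N * q ∨ N * q' = N * q + N := by
  have hN : 0 < N := by omega
  have h3 : -1 < q' - q := by
    by_contra hc
    nlinarith
  have h4 : q' - q < 2 := by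
    by_contra hc
    nlinarith
  rcases (show q' = q ∨ q' = q + 1 by omega) with rfl | rfl
  · exact Or.inl rfl
  · exact Or.inr (by ring)

theorem sbtw_intCast {a b c : ℤ} (h1 : a < b) (h2 : b < c) (h3 : c < a + N) :
    sbtw (a : ZMod N) (b : ZMod N) (c : ZMod N) := by
  rw [zmod_sbtw_iff]
  obtain ⟨qa, ha⟩ := exists_val_eq (N := N) a
  obtain ⟨qb, hb⟩ := exists_val_eq (N := N) b
  obtain ⟨qc, hc⟩ := exists_val_eq (N := N) c
  have la := ZMod.val_lt (a : ZMod N)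
  have lb := ZMod.val_lt (b : ZMod N)
  have lc := ZMod.val_lt (c : ZMod N)
  have h4 := quotient_cases (N := N) (q := qa) (q' := qb) (Int.natCast_nonneg _)
    (by exact_mod_cast la) (Int.natCast_nonneg _) (by exact_mod_cast lb) (by omega) (by omega)
  have h5 := quotient_cases (N := N) (q := qa) (q' := qc) (Int.natCast_nonneg _)
    (by exact_mod_cast la) (Int.natCast_nonneg _) (by exact_mod_cast lc) (by omega) (by omega)
  omega

theorem exists_intCast_of_sbtw {a b : ℤ} {z : ZMod N} (h1 : a < b) (h2 : b < a + N)
    (h : sbtw (a : ZMod N) z (b : ZMod N)) : ∃ c : ℤ, a < c ∧ c < b ∧ (c : ZMod N) = z := by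
  rw [zmod_sbtw_iff] at h
  obtain ⟨qa, ha⟩ := exists_val_eq (N := N) a
  obtain ⟨qb, hb⟩ := exists_val_eq (N := N) b
  have la := ZMod.val_lt (a : ZMod N)
  have lb := ZMod.val_lt (b : ZMod N)
  have lz := ZMod.val_lt z
  have h4 := quotient_cases (N := N) (q := qa) (q' := qb) (Int.natCast_nonneg _)
    (by exact_mod_cast la) (Int.natCast_nonneg _) (by exact_mod_cast lb) (by omega) (by omega)
  rcases lt_or_ge (a : ZMod N).val z.val with h5 | h5
  · exact ⟨z.val + N * qa, by omega, by omega, by simp⟩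
  · exact ⟨z.val + N * qa + N, by omega, by omega, by simp⟩

end ZModOrder

theorem eq_of_intCast_eq {N : ℕ} {a b : ℤ} (h : (a : ZMod N) = b) (h1 : a < b + N)
    (h2 : b < a + N) : a = b := by
  rw [ZMod.intCast_eq_intCast_iff] at h
  obtain ⟨k, hk⟩ := h.dvd
  have : -1 < k := by
    by_contra hc
    nlinarith
  have : k < 1 := by
    by_contra hc
    nlinarith
  obtain rfl : k = 0 := by omega
  linarith

section PolygonCrossing

variable {N : ℕ} [NeZero N]

theorem crosses_of_lt {e f : Edge (ZMod N)} {a b c d : ℤ} (he : e.1 = s((a : ZMod N), (b : ZMod N)))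
    (hf : f.1 = s((c : ZMod N), (d : ZMod N))) (h : a < c ∧ c < b ∧ b < d ∧ d < a + N) :
    e.Crosses f := by
  refine ⟨a, b, c, d, he, hf, sbtw_intCast h.1 h.2.1 (by omega), ?_⟩
  have := sbtw_intCast (N := N) (a := b) (b := d) (c := a + N) (by omega) (by omega) (by omega)
  simpa using this

theorem Edge.Crosses.exists_lt {e f : Edge (ZMod N)} (h : e.Crosses f) {a b : ℤ}
    (he : e.1 = s((a : ZMod N), (b : ZMod N))) (hab : a < b) (hba : b < a + N) :
    ∃ c d : ℤ, (a < c ∧ c < b ∧ b < d ∧ d < a + N) ∧ f.1 = s((c : ZMod N), (d : ZMod N)) := by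
  obtain ⟨x, y, z, w, he', hf, h1, h2⟩ := h
  rw [he, Sym2.eq_iff] at he'
  have hcast : ((a + N : ℤ) : ZMod N) = a := by simp
  rcases he' with ⟨rfl, rfl⟩ | ⟨rfl, rfl⟩
  · obtain ⟨c, hc1, hc2, rfl⟩ := exists_intCast_of_sbtw hab hba h1
    rw [← hcast] at h2
    obtain ⟨d, hd1, hd2, rfl⟩ := exists_intCast_of_sbtw hba (by omega) h2
    exact ⟨c, d, by omega, hf⟩
  · obtain ⟨c, hc1, hc2, rfl⟩ := exists_intCast_of_sbtw hab hba h2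
    rw [← hcast] at h1
    obtain ⟨d, hd1, hd2, rfl⟩ := exists_intCast_of_sbtw hba (by omega) h1
    exact ⟨c, d, by omega, by rw [hf, Sym2.eq_swap]⟩

/-- Crossing `e` places one endpoint of `f` and of `g` on each side of `[a, b]`; that `f` and `g`
cross forces the same order on both sides. -/
theorem exists_lt_of_three_crosses {e f g : Edge (ZMod N)} (h1 : e.Crosses f) (h2 : e.Crosses g)
    (h3 : f.Crosses g) {a b : ℤ} (he : e.1 = s((a : ZMod N), (b : ZMod N))) (hab : a < b)
    (hba : b < a + N) : ∃ c x d y : ℤ, (a < c ∧ c < x ∧ x < b ∧ b < d ∧ d < y ∧ y < a + N) ∧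
      ((f.1 = s((c : ZMod N), (d : ZMod N)) ∧ g.1 = s((x : ZMod N), (y : ZMod N))) ∨
        (g.1 = s((c : ZMod N), (d : ZMod N)) ∧ f.1 = s((x : ZMod N), (y : ZMod N)))) := by
  obtain ⟨c, d, hcd, hf⟩ := h1.exists_lt he hab hba
  obtain ⟨x, y, hxy, hg⟩ := h2.exists_lt he hab hba
  obtain ⟨x', y', hxy', hg'⟩ := h3.exists_lt hf (by omega) (by omega)
  rw [hg, Sym2.eq_iff] at hg'
  have hshift : ∀ z : ℤ, ((z - N : ℤ) : ZMod N) = z := fun z => by simp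
  rcases hg' with ⟨e1, e2⟩ | ⟨e1, e2⟩
  · obtain rfl := eq_of_intCast_eq e1 (by omega) (by omega)
    obtain rfl : y = y' := by
      rcases lt_or_ge y' (y + N) with h | h
      · exact eq_of_intCast_eq e2 (by omega) (by omega)
      · omega
    exact ⟨c, x, d, y, by omega, Or.inl ⟨hf, hg⟩⟩
  · obtain rfl := eq_of_intCast_eq e2 (by omega) (by omega)
    rw [← hshift y'] at e1
    have := eq_of_intCast_eq e1 (by omega) (by omega)
    exact ⟨x, c, y, d, by omega, Or.inr ⟨hg, hf⟩⟩

end PolygonCrossing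

/-- The relation on integer labels given by a set of edges of the `N`-gon. -/
def Rel {N : ℕ} (T : Set (Edge (ZMod N))) (u v : ℤ) : Prop :=
  ∃ e ∈ T, e.1 = s((u : ZMod N), (v : ZMod N))

theorem rel_iff_mem {N : ℕ} {T : Set (Edge (ZMod N))} {e : Edge (ZMod N)} {u v : ℤ}
    (he : e.1 = s((u : ZMod N), (v : ZMod N))) : Rel T u v ↔ e ∈ T :=
  ⟨fun ⟨_, hf, hfe⟩ => (Subtype.ext (hfe.trans he.symm)) ▸ hf, fun h => ⟨e, h, he⟩⟩

theorem exists_labels {N : ℕ} [NeZero N] (e : Edge (ZMod N)) :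
    ∃ u v : ℤ, u < v ∧ v < u + N ∧ e.1 = s((u : ZMod N), (v : ZMod N)) := by
  obtain ⟨e, he⟩ := e
  induction e with
  | h x y =>
    have hxy : x.val ≠ y.val := fun h => he (ZMod.val_injective N h)
    have hx := ZMod.val_lt x
    have hy := ZMod.val_lt y
    rcases lt_or_gt_of_ne hxy with h | h
    · exact ⟨x.val, y.val, by omega, by omega, by simp⟩
    · exact ⟨y.val, x.val, by omega, by omega, by simp [Sym2.eq_swap]⟩

theorem exists_edge {N : ℕ} {u v : ℤ} (h1 : u < v) (h2 : v < u + N) :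
    ∃ e : Edge (ZMod N), e.1 = s((u : ZMod N), (v : ZMod N)) :=
  ⟨⟨s((u : ZMod N), (v : ZMod N)), fun h => h1.ne
    (eq_of_intCast_eq (Sym2.mk_isDiag_iff.1 h) (by omega) (by omega))⟩, rfl⟩

theorem crossingFree_iff_free {N : ℕ} [NeZero N] {T : Set (Edge (ZMod N))} :
    CrossingFree 3 T ↔ Free N (Rel T) := by
  rw [crossingFree_three_iff]
  constructor
  · rintro h a₁ a₂ a₃ b₁ b₂ b₃ ho ⟨e, he, he'⟩ ⟨f, hf, hf'⟩ ⟨g, hg, hg'⟩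
    exact h e he f hf g hg (crosses_of_lt he' hf' (by omega)) (crosses_of_lt he' hg' (by omega))
      (crosses_of_lt hf' hg' (by omega))
  · intro h e he f hf g hg h1 h2 h3
    obtain ⟨a, b, hab, hba, he'⟩ := exists_labels e
    obtain ⟨c, x, d, y, ho, ⟨h4, h5⟩ | ⟨h4, h5⟩⟩ := exists_lt_of_three_crosses h1 h2 h3 he' hab hba
    · exact h a c x b d y (by omega) ⟨e, he, he'⟩ ⟨f, hf, h4⟩ ⟨g, hg, h5⟩
    · exact h a c x b d y (by omega) ⟨e, he, he'⟩ ⟨g, hg, h4⟩ ⟨f, hf, h5⟩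

section IntCrossing

theorem int_crosses_of_lt {e f : Edge ℤ} {a b c d : ℤ} (he : e.1 = s(a, b))
    (hf : f.1 = s(c, d)) (h : a < c ∧ c < b ∧ b < d) : e.Crosses f :=
  ⟨a, b, c, d, he, hf, Or.inl ⟨h.1, h.2.1⟩, Or.inr (Or.inr ⟨by omega, h.2.2⟩)⟩

theorem Edge.Crosses.int_lt {e f : Edge ℤ} (h : e.Crosses f) {a b c d : ℤ} (he : e.1 = s(a, b))
    (hf : f.1 = s(c, d)) (hab : a < b) (hcd : c < d) :
    (a < c ∧ c < b ∧ b < d) ∨ (c < a ∧ a < d ∧ d < b) := by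
  obtain ⟨x, y, z, w, he', hf', h1, h2⟩ := h
  rw [he, Sym2.eq_iff] at he'
  rw [hf, Sym2.eq_iff] at hf'
  rw [Int.sbtw_iff] at h1 h2
  omega

theorem int_exists_labels (e : Edge ℤ) : ∃ u v : ℤ, u < v ∧ e.1 = s(u, v) := by
  obtain ⟨e, he⟩ := e
  induction e with
  | h x y =>
    have hxy : x ≠ y := fun h => he h
    rcases lt_or_gt_of_ne hxy with h | h
    · exact ⟨x, y, h, rfl⟩
    · exact ⟨y, x, h, Sym2.eq_swap⟩

/-- The relation on integers given by a set of edges of the universal cover. -/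
def IntRel (T : Set (Edge ℤ)) (u v : ℤ) : Prop := ∃ e ∈ T, e.1 = s(u, v)

theorem int_crossingFree_iff {T : Set (Edge ℤ)} : CrossingFree 3 T ↔
    ∀ a₁ a₂ a₃ b₁ b₂ b₃ : ℤ, a₁ < a₂ ∧ a₂ < a₃ ∧ a₃ < b₁ ∧ b₁ < b₂ ∧ b₂ < b₃ →
      IntRel T a₁ b₁ → IntRel T a₂ b₂ → IntRel T a₃ b₃ → False := by
  rw [crossingFree_three_iff]
  constructor
  · rintro h a₁ a₂ a₃ b₁ b₂ b₃ ho ⟨e, he, he'⟩ ⟨f, hf, hf'⟩ ⟨g, hg, hg'⟩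
    exact h e he f hf g hg (int_crosses_of_lt he' hf' (by omega))
      (int_crosses_of_lt he' hg' (by omega)) (int_crosses_of_lt hf' hg' (by omega))
  · intro h e he f hf g hg h1 h2 h3
    obtain ⟨a, b, hab, he'⟩ := int_exists_labels e
    obtain ⟨c, d, hcd, hf'⟩ := int_exists_labels f
    obtain ⟨x, y, hxy, hg'⟩ := int_exists_labels g
    have r1 : IntRel T a b := ⟨e, he, he'⟩
    have r2 : IntRel T c d := ⟨f, hf, hf'⟩
    have r3 : IntRel T x y := ⟨g, hg, hg'⟩
    rcases h1.int_lt he' hf' hab hcd with k1 | k1 <;> rcases h2.int_lt he' hg' hab hxy with k2 | k2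
      <;> rcases h3.int_lt hf' hg' hcd hxy with k3 | k3
    · exact h _ _ _ _ _ _ (by omega) r1 r2 r3
    · exact h _ _ _ _ _ _ (by omega) r1 r3 r2
    · omega
    · exact h _ _ _ _ _ _ (by omega) r3 r1 r2
    · exact h _ _ _ _ _ _ (by omega) r2 r1 r3
    · omega
    · exact h _ _ _ _ _ _ (by omega) r2 r3 r1
    · exact h _ _ _ _ _ _ (by omega) r3 r2 r1

end IntCrossing

end Multitriangulation

/-! ### Edges of the half-cylinder as rotation orbits of edges of the polygon -/

namespace Multitriangulation

variable {n : ℕ}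

theorem coverLength_eq {e : Edge ℤ} {u v : ℤ} (h : e.1 = s(u, v)) :
    coverLength e = (v - u).natAbs := by
  rw [coverLength, h]; rfl

theorem Edge.shift_val {V : Type*} [AddCommGroup V] {e : Edge V} {u v : V} (c : V)
    (h : e.1 = s(u, v)) : (e.shift c).1 = s(u + c, v + c) := by
  change Sym2.map (· + c) e.1 = _
  rw [h]; rfl

theorem proj_eq_iff {e f : Edge ℤ} : proj n e = proj n f ↔ ∃ ℓ : ℤ, f = e.shift (ℓ • (n : ℤ)) :=
  Quotient.eq

theorem cylLength_proj (e : Edge ℤ) : cylLength (proj n e) = coverLength e := rfl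

/-- `E` is a lift of `e`, of length at most half of the polygon. -/
def IsShortLift (n : ℕ) (e : Edge (ZMod (4 * n))) (E : Edge ℤ) : Prop :=
  coverLength E ≤ 2 * n ∧ e.1 = E.1.map (fun i : ℤ => (i : ZMod (4 * n)))

theorem isShortLift_iff {e : Edge (ZMod (4 * n))} {E : Edge ℤ} {u v : ℤ} (hE : E.1 = s(u, v)) :
    IsShortLift n e E ↔ (v - u).natAbs ≤ 2 * n ∧
      e.1 = s((u : ZMod (4 * n)), (v : ZMod (4 * n))) := by
  rw [IsShortLift, coverLength_eq hE, hE]; rfl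

theorem exists_isShortLift [NeZero n] (e : Edge (ZMod (4 * n))) : ∃ E, IsShortLift n e E := by
  obtain ⟨u, v, h1, h2, he⟩ := exists_labels e
  push_cast at h2
  rcases le_or_gt (v - u) (2 * n) with h | h
  · exact ⟨⟨s(u, v), fun hd => h1.ne hd⟩, (isShortLift_iff rfl).2 ⟨by omega, he⟩⟩
  · refine ⟨⟨s(v, u + 4 * n), fun hd => h2.ne hd⟩, (isShortLift_iff rfl).2 ⟨by omega, ?_⟩⟩
    rw [he, Sym2.eq_swap]
    have : ((4 * n : ℤ) : ZMod (4 * n)) = 0 := by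
      have := ZMod.natCast_self (4 * n)
      push_cast at this ⊢
      exact this
    push_cast at this ⊢
    rw [this, add_zero]

/-- Short lifts of a non-diameter differ by multiples of `4n`. A diameter also has lifts read from
its other endpoint, but these are translates by odd multiples of `2n`, still multiples of `n`. -/
theorem proj_eq_of_isShortLift [NeZero n] {e : Edge (ZMod (4 * n))} {E E' : Edge ℤ}
    (h : IsShortLift n e E) (h' : IsShortLift n e E') : proj n E = proj n E' := by
  obtain ⟨u, v, huv, hE⟩ := int_exists_labels E
  obtain ⟨u', v', huv', hE'⟩ := int_exists_labels E'
  rw [isShortLift_iff hE] at h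
  rw [isShortLift_iff hE'] at h'
  have hn : (0 : ℤ) < n := by exact_mod_cast NeZero.pos n
  have hb : v - u ≤ 2 * n := by omega
  have hb' : v' - u' ≤ 2 * n := by omega
  rw [proj_eq_iff]
  have he := h.2.symm.trans h'.2
  rw [Sym2.eq_iff] at he
  simp only [ZMod.intCast_eq_intCast_iff] at he
  rcases he with ⟨h1, h2⟩ | ⟨h1, h2⟩
  · obtain ⟨k, hk⟩ := h1.dvd
    obtain ⟨l, hl⟩ := h2.dvd
    push_cast at hk hl
    have e1 : v' - u' = v - u + 4 * n * (l - k) := by linarith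
    have : -1 < l - k := by
      by_contra hc
      nlinarith
    have : l - k < 1 := by
      by_contra hc
      nlinarith
    obtain rfl : l = k := by omega
    refine ⟨4 * l, Subtype.ext ?_⟩
    rw [hE', Edge.shift_val _ hE, Sym2.eq_iff]
    left
    constructor <;> simp <;> linarith
  · obtain ⟨k, hk⟩ := h1.dvd
    obtain ⟨l, hl⟩ := h2.dvd
    push_cast at hk hl
    have e1 : (v' - u') + (v - u) = 4 * n * (k - l) := by linarith
    have : 0 < k - l := by
      by_contra hc
      nlinarith
    have : k - l < 2 := by
      by_contra hc
      nlinarith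
    obtain rfl : k = l + 1 := by omega
    refine ⟨4 * l + 2, Subtype.ext ?_⟩
    rw [hE', Edge.shift_val _ hE, Sym2.eq_iff]
    left
    have : v' - u' = 2 * n := by
      have : (4 * n * (l + 1 - l) : ℤ) = 4 * n := by ring
      omega
    constructor <;> simp <;> linarith

/-- The edge of the half-cylinder corresponding to an edge of the `4n`-gon. -/
noncomputable def cylEdge [NeZero n] (e : Edge (ZMod (4 * n))) : CylEdge n :=
  proj n (exists_isShortLift e).choose

theorem IsShortLift.cylEdge_eq [NeZero n] {e : Edge (ZMod (4 * n))} {E : Edge ℤ}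
    (h : IsShortLift n e E) : cylEdge e = proj n E :=
  proj_eq_of_isShortLift (exists_isShortLift e).choose_spec h

theorem IsShortLift.shift {e : Edge (ZMod (4 * n))} {E : Edge ℤ} (h : IsShortLift n e E) (ℓ : ℤ) :
    IsShortLift n (e.shift (ℓ • (n : ZMod (4 * n)))) (E.shift (ℓ • (n : ℤ))) := by
  obtain ⟨u, v, huv, hE⟩ := int_exists_labels E
  rw [isShortLift_iff hE] at h
  rw [isShortLift_iff (Edge.shift_val _ hE), Edge.shift_val _ h.2]
  refine ⟨by rw [show v + ℓ • (n : ℤ) - (u + ℓ • (n : ℤ)) = v - u by ring]; exact h.1, ?_⟩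
  simp

theorem cylEdge_eq_iff [NeZero n] {e f : Edge (ZMod (4 * n))} :
    cylEdge e = cylEdge f ↔ f ∈ e.orbit (n : ZMod (4 * n)) := by
  obtain ⟨E, hE⟩ := exists_isShortLift e
  obtain ⟨F, hF⟩ := exists_isShortLift f
  constructor
  · rw [hE.cylEdge_eq, hF.cylEdge_eq, proj_eq_iff]
    rintro ⟨ℓ, rfl⟩
    exact ⟨ℓ, Subtype.ext (hF.2.trans (hE.shift ℓ).2.symm)⟩
  · rintro ⟨ℓ, rfl⟩
    rw [hE.cylEdge_eq, (hE.shift ℓ).cylEdge_eq, proj_eq_iff]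
    exact ⟨ℓ, rfl⟩

theorem cylLength_cylEdge_le [NeZero n] (e : Edge (ZMod (4 * n))) :
    cylLength (cylEdge e) ≤ 2 * n := by
  obtain ⟨E, hE⟩ := exists_isShortLift e
  rw [hE.cylEdge_eq, cylLength_proj]
  exact hE.1

theorem exists_isShortLift_of_le [NeZero n] {E : Edge ℤ} (hE : coverLength E ≤ 2 * n) :
    ∃ e, IsShortLift n e E := by
  have hn := NeZero.pos n
  obtain ⟨u, v, huv, he⟩ := int_exists_labels E
  rw [coverLength_eq he] at hE
  obtain ⟨e, he'⟩ := exists_edge (N := 4 * n) huv (by push_cast; omega)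
  exact ⟨e, (isShortLift_iff he).2 ⟨hE, he'⟩⟩

theorem exists_cylEdge_eq [NeZero n] {c : CylEdge n} (hc : cylLength c ≤ 2 * n) :
    ∃ e, cylEdge e = c := by
  obtain ⟨E, rfl⟩ := Quotient.exists_rep c
  obtain ⟨e, he⟩ := exists_isShortLift_of_le (n := n) (E := E) hc
  exact ⟨e, he.cylEdge_eq⟩

theorem polyLength_eq [NeZero n] (e : Edge (ZMod (4 * n))) :
    polyLength e = cylLength (cylEdge e) := by
  obtain ⟨E, hE⟩ := exists_isShortLift e
  rw [hE.cylEdge_eq, cylLength_proj]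
  obtain ⟨u, v, huv, he⟩ := int_exists_labels E
  rw [isShortLift_iff he] at hE
  rw [coverLength_eq he, polyLength, hE.2]
  change ((v : ZMod (4 * n)) - (u : ZMod (4 * n))).valMinAbs.natAbs = _
  rw [← Int.cast_sub]
  refine le_antisymm ?_ ?_
  · exact ZMod.natAbs_min_of_le_div_two (4 * n) _ _ (by simp) (ZMod.natAbs_valMinAbs_le _)
  · exact ZMod.natAbs_min_of_le_div_two (4 * n) _ _ (by simp) (by omega)

/-- The edges of the `4n`-gon corresponding to a set of edges of the half-cylinder. -/
noncomputable def wrap [NeZero n] (S : Set (CylEdge n)) : Set (Edge (ZMod (4 * n))) := cylEdge ⁻¹' S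

theorem periodic_rel [NeZero n] {T : Set (Edge (ZMod (4 * n)))}
    (hT : ∀ e, e.shift (n : ZMod (4 * n)) ∈ T ↔ e ∈ T) : Periodic n (Rel T) where
  symm := by
    rintro u v ⟨e, he, he'⟩
    exact ⟨e, he, by rw [he', Sym2.eq_swap]⟩
  add_right u v := by
    have : ((4 * n : ℤ) : ZMod (4 * n)) = 0 := by
      have := ZMod.natCast_self (4 * n)
      push_cast at this ⊢
      exact this
    unfold Rel
    push_cast at this ⊢
    simp [this]
  rot u v := by
    constructor
    · rintro ⟨e, he, he'⟩
      refine ⟨e.shift (-(n : ZMod (4 * n))), ?_, ?_⟩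
      · rw [← hT, Edge.shift_shift, neg_add_cancel, Edge.shift_zero]
        exact he
      · rw [Edge.shift_val _ he']
        simp
    · rintro ⟨e, he, he'⟩
      refine ⟨e.shift (n : ZMod (4 * n)), (hT e).2 he, ?_⟩
      rw [Edge.shift_val _ he']
      simp
  irrefl := by
    rintro u ⟨e, he, he'⟩
    exact e.2 (by rw [he']; exact Sym2.mk_isDiag_iff.2 rfl)

theorem cylEdge_shift [NeZero n] (e : Edge (ZMod (4 * n))) :
    cylEdge (e.shift (n : ZMod (4 * n))) = cylEdge e :=
  (cylEdge_eq_iff.2 ⟨1, by simp⟩).symm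

theorem shift_mem_wrap [NeZero n] (S : Set (CylEdge n)) (e : Edge (ZMod (4 * n))) :
    e.shift (n : ZMod (4 * n)) ∈ wrap S ↔ e ∈ wrap S := by
  rw [wrap, Set.mem_preimage, Set.mem_preimage, cylEdge_shift]

theorem periodic_rel_wrap [NeZero n] (S : Set (CylEdge n)) : Periodic n (Rel (wrap S)) :=
  periodic_rel (shift_mem_wrap S)

theorem cylEdge_eq_iff_orb [NeZero n] {e f : Edge (ZMod (4 * n))} {p r u v : ℤ}
    (he : e.1 = s((p : ZMod (4 * n)), (r : ZMod (4 * n))))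
    (hf : f.1 = s((u : ZMod (4 * n)), (v : ZMod (4 * n)))) :
    cylEdge f = cylEdge e ↔ Orb n p r u v := by
  rw [eq_comm, cylEdge_eq_iff]
  have hd : ∀ a b : ℤ, (a : ZMod (4 * n)) = b ↔ ∃ m : ℤ, b = a + m * (4 * n) := by
    intro a b
    rw [ZMod.intCast_eq_intCast_iff, Int.modEq_iff_dvd]
    push_cast
    exact ⟨fun ⟨m, hm⟩ => ⟨m, by linarith⟩, fun ⟨m, hm⟩ => ⟨m, by linarith⟩⟩
  have hsh : ∀ ℓ : ℤ, (e.shift (ℓ • (n : ZMod (4 * n)))).1 =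
      s(((p + ℓ * n : ℤ) : ZMod (4 * n)), ((r + ℓ * n : ℤ) : ZMod (4 * n))) := by
    intro ℓ
    rw [Edge.shift_val _ he]
    simp
  constructor
  · rintro ⟨ℓ, rfl⟩
    have h := (hsh ℓ).symm.trans hf
    rw [Sym2.eq_iff, hd, hd, hd, hd] at h
    rcases h with ⟨⟨m, hm⟩, ⟨k, hk⟩⟩ | ⟨⟨m, hm⟩, ⟨k, hk⟩⟩
    · exact ⟨ℓ + 4 * m, ℓ + 4 * k, by omega, Or.inl ⟨by linarith, by linarith⟩⟩
    · exact ⟨ℓ + 4 * k, ℓ + 4 * m, by omega, Or.inr ⟨by linarith, by linarith⟩⟩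
  · rintro ⟨j, k, ⟨m, hm⟩, ⟨h1, h2⟩ | ⟨h1, h2⟩⟩
    · refine ⟨j, Subtype.ext ?_⟩
      rw [hsh, hf, Sym2.eq_iff, hd, hd, hd, hd]
      exact Or.inl ⟨⟨0, by linarith⟩, ⟨-m, by rw [h2, show k = j + 4 * m by linarith]; ring⟩⟩
    · refine ⟨j, Subtype.ext ?_⟩
      rw [hsh, hf, Sym2.eq_iff, hd, hd, hd, hd]
      exact Or.inr ⟨⟨0, by linarith⟩, ⟨-m, by rw [h2, show k = j + 4 * m by linarith]; ring⟩⟩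

theorem rel_wrap_insert [NeZero n] {S : Set (CylEdge n)} {e : Edge (ZMod (4 * n))} {p r u v : ℤ}
    (he : e.1 = s((p : ZMod (4 * n)), (r : ZMod (4 * n)))) :
    Rel (wrap (insert (cylEdge e) S)) u v → Rel (wrap S) u v ∨ Orb n p r u v := by
  rintro ⟨f, hf, hf'⟩
  rcases hf with hf | hf
  · exact Or.inr ((cylEdge_eq_iff_orb he hf').1 hf)
  · exact Or.inl ⟨f, hf, hf'⟩

end Multitriangulation

/-! ### Triangulations of the half-cylinder as periodic triangulations, and their flips -/

namespace Multitriangulation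

variable {n : ℕ} {S : Set (CylEdge n)}

theorem intRel_iff_mem {T : Set (Edge ℤ)} {e : Edge ℤ} {u v : ℤ} (he : e.1 = s(u, v)) :
    IntRel T u v ↔ e ∈ T :=
  ⟨fun ⟨_, hf, hfe⟩ => (Subtype.ext (hfe.trans he.symm)) ▸ hf, fun h => ⟨e, h, he⟩⟩

theorem intRel_lift_add {u v : ℤ} (h : IntRel (lift S) u v) (t : ℤ) :
    IntRel (lift S) (u + t * n) (v + t * n) := by
  obtain ⟨E, hE, hE'⟩ := h
  refine ⟨E.shift (t • (n : ℤ)), ?_, ?_⟩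
  · have : proj n (E.shift (t • (n : ℤ))) = proj n E := (proj_eq_iff.2 ⟨t, rfl⟩).symm
    change proj n _ ∈ S
    rw [this]
    exact hE
  · rw [Edge.shift_val _ hE']
    simp

variable [NeZero n]

theorem intRel_lift_iff {u v : ℤ} (h1 : u < v) (h2 : v ≤ u + 2 * n) :
    IntRel (lift S) u v ↔ Rel (wrap S) u v := by
  have hn := NeZero.pos n
  obtain ⟨e, he⟩ := exists_edge (N := 4 * n) h1 (by push_cast; omega)
  obtain ⟨E, hE⟩ : ∃ E : Edge ℤ, E.1 = s(u, v) := ⟨⟨s(u, v), fun hd => h1.ne hd⟩, rfl⟩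
  have hs : IsShortLift n e E := (isShortLift_iff hE).2 ⟨by omega, he⟩
  rw [intRel_iff_mem hE, rel_iff_mem he, wrap, Set.mem_preimage, hs.cylEdge_eq]
  rfl

/-- An edge longer than `2n` forms a `3`-crossing with its translates by `n` and `2n`. -/
theorem cylLength_le_of_crossingFree (h : CrossingFree 3 (lift S)) {c : CylEdge n} (hc : c ∈ S) :
    cylLength c ≤ 2 * n := by
  obtain ⟨E, rfl⟩ := Quotient.exists_rep c
  have hn := NeZero.pos n
  change coverLength E ≤ 2 * n
  obtain ⟨u, v, huv, he⟩ := int_exists_labels E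
  rw [coverLength_eq he]
  by_contra hlen
  have h0 : IntRel (lift S) u v := ⟨E, hc, he⟩
  exact int_crossingFree_iff.1 h _ _ _ _ _ _ (by omega) h0 (intRel_lift_add h0 1)
    (intRel_lift_add h0 2)

theorem crossingFree_lift_iff (hS : ∀ c ∈ S, cylLength c ≤ 2 * n) :
    CrossingFree 3 (lift S) ↔ Free (4 * n) (Rel (wrap S)) := by
  have hn : (0 : ℤ) < n := by exact_mod_cast NeZero.pos n
  rw [int_crossingFree_iff]
  have hP := periodic_rel_wrap S
  constructor
  · intro h
    -- every edge goes around the shorter way, forwards or backwards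
    have hW : ∀ a₁ a₂ a₃ b₁ b₂ b₃ : ℤ, a₁ < a₂ ∧ a₂ < a₃ ∧ a₃ < b₁ ∧ b₁ < b₂ ∧ b₂ < b₃ →
        b₁ ≤ a₁ + 2 * n → b₂ ≤ a₂ + 2 * n → b₃ ≤ a₃ + 2 * n → Rel (wrap S) a₁ b₁ →
        Rel (wrap S) a₂ b₂ → Rel (wrap S) a₃ b₃ → False := fun a₁ a₂ a₃ b₁ b₂ b₃ ho l1 l2 l3 h1 h2 h3 =>
      h a₁ a₂ a₃ b₁ b₂ b₃ ho ((intRel_lift_iff (by omega) l1).2 h1)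
        ((intRel_lift_iff (by omega) l2).2 h2) ((intRel_lift_iff (by omega) l3).2 h3)
    have hs : ∀ x y, Rel (wrap S) x y → Rel (wrap S) y (x + 4 * n) := fun x y h =>
      hP.move (hP.symm _ _ h) 0 4 (by ring) (by ring) (by norm_num)
    -- Here the short lifts need not cross pairwise in the cover. Replacing the middle edge by its
    -- half turn, read from the other end, gives a short edge `[b₂ - 2n, a₂ + 2n]` that crosses both
    -- others there.
    have alt : ∀ a₁ a₂ a₃ b₁ b₂ b₃ : ℤ, a₁ < a₂ ∧ a₂ < a₃ ∧ a₃ < b₁ ∧ b₁ < b₂ ∧ b₂ < b₃ ∧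
        b₃ < a₁ + 4 * n → b₁ ≤ a₁ + 2 * n → a₂ + 2 * n ≤ b₂ → b₃ ≤ a₃ + 2 * n →
        Rel (wrap S) a₁ b₁ → Rel (wrap S) a₂ b₂ → Rel (wrap S) a₃ b₃ → False := by
      intro a₁ a₂ a₃ b₁ b₂ b₃ ho l1 l2 l3 h1 h2 h3
      have c1 : b₃ ≤ a₂ + 2 * n := by
        by_contra hc
        rcases lt_or_ge (a₂ + 2 * n) b₁ with h4 | h4
        · omega
        · exact hW a₁ (b₂ - 2 * n) a₃ b₁ (a₂ + 2 * n) b₃ (by omega) l1 (by omega) l3 h1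
            (hP.move (hs _ _ h2) (-2) (-2) (by ring) (by ring) (by norm_num)) h3
      have c2 : a₂ + 4 * n ≤ b₁ + 2 * n := by
        by_contra hc
        exact hW a₃ (a₁ + 2 * n) b₂ b₃ (b₁ + 2 * n) (a₂ + 4 * n) (by omega) l3 (by omega)
          (by omega) h3 (hP.move h1 2 2 (by ring) (by ring) (by norm_num)) (hs _ _ h2)
      omega
    intro a₁ a₂ a₃ b₁ b₂ b₃ ho h1 h2 h3
    -- Six consecutive endpoints can be read starting from any of them. In all but two of the
    -- patterns some starting point makes all three edges short; the other two are instances of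
    -- `alt`.
    rcases le_total b₁ (a₁ + 2 * n) with l1 | l1 <;> rcases le_total b₂ (a₂ + 2 * n) with l2 | l2 <;>
      rcases le_total b₃ (a₃ + 2 * n) with l3 | l3
    · exact hW a₁ a₂ a₃ b₁ b₂ b₃ (by omega) l1 l2 l3 h1 h2 h3
    · exact hW b₃ (a₁ + 4 * n) (a₂ + 4 * n) (a₃ + 4 * n) (b₁ + 4 * n) (b₂ + 4 * n) (by omega)
        (by omega) (by omega) (by omega) (hs _ _ h3) (hP.move h1 4 4 (by ring) (by ring) (by norm_num))
        (hP.move h2 4 4 (by ring) (by ring) (by norm_num))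
    · exact alt a₁ a₂ a₃ b₁ b₂ b₃ (by omega) l1 l2 l3 h1 h2 h3
    · exact hW b₂ b₃ (a₁ + 4 * n) (a₂ + 4 * n) (a₃ + 4 * n) (b₁ + 4 * n) (by omega) (by omega)
        (by omega) (by omega) (hs _ _ h2) (hs _ _ h3)
        (hP.move h1 4 4 (by ring) (by ring) (by norm_num))
    · exact hW a₂ a₃ b₁ b₂ b₃ (a₁ + 4 * n) (by omega) l2 l3 (by omega) h2 h3 (hs _ _ h1)
    · exact alt a₂ a₃ b₁ b₂ b₃ (a₁ + 4 * n) (by omega) l2 l3 (by omega) h2 h3 (hs _ _ h1)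
    · exact hW a₃ b₁ b₂ b₃ (a₁ + 4 * n) (a₂ + 4 * n) (by omega) l3 (by omega) (by omega) h3
        (hs _ _ h1) (hs _ _ h2)
    · exact hW b₁ b₂ b₃ (a₁ + 4 * n) (a₂ + 4 * n) (a₃ + 4 * n) (by omega) (by omega) (by omega)
        (by omega) (hs _ _ h1) (hs _ _ h2) (hs _ _ h3)
  · intro h a₁ a₂ a₃ b₁ b₂ b₃ ho h1 h2 h3
    have hlen : ∀ u v, u < v → IntRel (lift S) u v → v ≤ u + 2 * n := by
      rintro u v huv ⟨E, hE, hE'⟩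
      have := hS _ hE
      rw [cylLength_proj, coverLength_eq hE'] at this
      omega
    have l1 := hlen _ _ (by omega) h1
    have l2 := hlen _ _ (by omega) h2
    have l3 := hlen _ _ (by omega) h3
    -- The length bound fits the crossing within one turn: `b₃ ≤ a₃ + 2n < b₁ + 2n ≤ a₁ + 4n`.
    exact h a₁ a₂ a₃ b₁ b₂ b₃ (by omega) ((intRel_lift_iff (by omega) l1).1 h1)
      ((intRel_lift_iff (by omega) l2).1 h2) ((intRel_lift_iff (by omega) l3).1 h3)

theorem cylEdge_mem_iff {e : Edge (ZMod (4 * n))} {u v : ℤ}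
    (he : e.1 = s((u : ZMod (4 * n)), (v : ZMod (4 * n)))) :
    cylEdge e ∈ S ↔ Rel (wrap S) u v :=
  (rel_iff_mem (T := wrap S) he).symm

/-- Maximality on the half-cylinder only allows whole orbits to be added. By `free_union_orb_or`, an
unblocked missing edge always yields some missing orbit that can be added, so every missing edge is
blocked. -/
theorem tri_of_maximal (h : Maximal (fun S : Set (CylEdge n) => CrossingFree 3 (lift S)) S) :
    Tri n (Rel (wrap S)) := by
  have hn : (0 : ℤ) < n := by exact_mod_cast NeZero.pos n
  have hb : ∀ c ∈ S, cylLength c ≤ 2 * n := fun c hc => cylLength_le_of_crossingFree h.1 hc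
  have hP := periodic_rel_wrap S
  have hF := (crossingFree_lift_iff hb).1 h.1
  have hmax : ∀ u v : ℤ, u < v → v < u + 4 * n →
      Free (4 * n) (fun x y => Rel (wrap S) x y ∨ Orb n u v x y) → Rel (wrap S) u v := by
    intro u v h1 h2 hf
    obtain ⟨e, he⟩ := exists_edge (N := 4 * n) h1 (by push_cast; omega)
    rw [← cylEdge_mem_iff he]
    refine h.2 (y := insert (cylEdge e) S) ?_ (Set.subset_insert _ _) (Set.mem_insert _ _)
    refine (crossingFree_lift_iff ?_).2 (hf.mono fun x y => rel_wrap_insert he)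
    rintro c (rfl | hc)
    · exact cylLength_cylEdge_le e
    · exact hb c hc
  refine ⟨hP, hn, hF, fun u v h1 h2 hno => ?_⟩
  by_contra hnb
  rcases free_union_orb_or hP hF hn h1 h2 hnb with hf | ⟨h3, h4, hf⟩ | ⟨h3, h4, hf⟩
  · exact hno (hmax u v h1 h2 hf)
  · exact h4 (hmax _ _ (by omega) (by omega) hf)
  · exact h4 (hmax _ _ (by omega) (by omega) hf)

theorem Blocked.not_rel_of_free {N u v : ℤ} {P : ℤ → ℤ → Prop} (h : Blocked N P u v)
    (hF : Free N P) : ¬ P u v := by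
  obtain ⟨a, a', b, b', ho, h1, h2⟩ := h
  exact fun h0 => hF u a a' v b b' (by omega) h0 h1 h2

theorem maximal_of_tri (hb : ∀ c ∈ S, cylLength c ≤ 2 * n) (h : Tri n (Rel (wrap S))) :
    Maximal (fun S : Set (CylEdge n) => CrossingFree 3 (lift S)) S := by
  refine ⟨(crossingFree_lift_iff hb).2 h.free, fun S' hS' hSS' c hc => ?_⟩
  have hb' : ∀ c ∈ S', cylLength c ≤ 2 * n := fun c hc => cylLength_le_of_crossingFree hS' hc
  obtain ⟨e, rfl⟩ := exists_cylEdge_eq (hb' c hc)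
  obtain ⟨u, v, h1, h2, he⟩ := exists_labels e
  rw [cylEdge_mem_iff he] at hc ⊢
  by_contra hno
  refine ((h.blocked u v h1 (by push_cast at h2; omega) hno).mono ?_).not_rel_of_free
    ((crossingFree_lift_iff hb').1 hS') hc
  rintro x y ⟨f, hf, hf'⟩
  exact ⟨f, hSS' hf, hf'⟩

theorem isPolyTriangulation_of_tri {T : Set (Edge (ZMod (4 * n)))} (h : Tri n (Rel T)) :
    IsPolyTriangulation (4 * n) 2 T := by
  have hN : ((4 * n : ℕ) : ℤ) = 4 * n := by push_cast; rfl
  refine ⟨crossingFree_iff_free.2 (by rw [hN]; exact h.free), fun T' hT' hTT' e he => ?_⟩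
  obtain ⟨u, v, h1, h2, hl⟩ := exists_labels e
  have hF := crossingFree_iff_free.1 hT'
  rw [hN] at hF h2
  rw [← rel_iff_mem hl] at he ⊢
  by_contra hno
  refine ((h.blocked u v h1 h2 hno).mono ?_).not_rel_of_free hF he
  rintro x y ⟨f, hf, hf'⟩
  exact ⟨f, hTT' hf, hf'⟩

theorem tri_of_isPolyTriangulation {T : Set (Edge (ZMod (4 * n)))}
    (h : IsPolyTriangulation (4 * n) 2 T) (hT : ∀ e, e.shift (n : ZMod (4 * n)) ∈ T ↔ e ∈ T) :
    Tri n (Rel T) := by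
  have hN : ((4 * n : ℕ) : ℤ) = 4 * n := by push_cast; rfl
  have hF := crossingFree_iff_free.1 h.1
  rw [hN] at hF
  refine ⟨periodic_rel hT, by exact_mod_cast NeZero.pos n, hF, fun u v h1 h2 hno => ?_⟩
  obtain ⟨e, he⟩ := exists_edge (N := 4 * n) h1 (by rw [hN]; exact h2)
  have heT : e ∉ T := fun hc => hno ((rel_iff_mem he).2 hc)
  have hcf : ¬ CrossingFree 3 (insert e T) := fun hc =>
    heT (h.2 hc (Set.subset_insert _ _) (Set.mem_insert _ _))
  rw [crossingFree_three_iff] at hcf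
  push Not at hcf
  obtain ⟨f₁, hf₁, f₂, hf₂, f₃, hf₃, c12, c13, c23, -⟩ := hcf
  have key : ∀ f ∈ T, ∀ g ∈ T, e.Crosses f → e.Crosses g → f.Crosses g →
      Blocked (4 * n) (Rel T) u v := by
    intro f hf g hg k1 k2 k3
    obtain ⟨c, x, d, y, ho, ⟨h4, h5⟩ | ⟨h4, h5⟩⟩ :=
      exists_lt_of_three_crosses k1 k2 k3 he h1 (by rw [hN]; exact h2)
    · exact ⟨c, x, d, y, by omega, ⟨f, hf, h4⟩, ⟨g, hg, h5⟩⟩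
    · exact ⟨c, x, d, y, by omega, ⟨g, hg, h4⟩, ⟨f, hf, h5⟩⟩
  have hmem : ∀ {f}, f ∈ insert e T → e ≠ f → f ∈ T := fun hf hne =>
    hf.resolve_left (Ne.symm hne)
  by_cases e1 : e = f₁
  · subst e1
    exact key f₂ (hmem hf₂ c12.ne) f₃ (hmem hf₃ c13.ne) c12 c13 c23
  by_cases e2 : e = f₂
  · subst e2
    exact key f₁ (hmem hf₁ e1) f₃ (hmem hf₃ c23.ne) c12.symm c23 c13
  by_cases e3 : e = f₃
  · subst e3
    exact key f₁ (hmem hf₁ e1) f₂ (hmem hf₂ e2) c13.symm c23.symm c12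
  exact ((crossingFree_three_iff.1 h.1) f₁ (hmem hf₁ e1) f₂ (hmem hf₂ e2) f₃ (hmem hf₃ e3)
    c12 c13 c23).elim

theorem wrap_image {T : Set (Edge (ZMod (4 * n)))}
    (hT : ∀ e, e.shift (n : ZMod (4 * n)) ∈ T ↔ e ∈ T) : wrap (cylEdge '' T) = T := by
  have hz : ∀ (ℓ : ℤ) e, e.shift (ℓ • (n : ZMod (4 * n))) ∈ T ↔ e ∈ T := by
    intro ℓ e
    induction ℓ using Int.induction_on with
    | zero => rw [zero_smul, Edge.shift_zero]
    | succ j ih => rw [add_smul, one_smul, ← Edge.shift_shift, hT, ih]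
    | pred j ih =>
      rw [← ih, ← hT (e.shift ((-(j : ℤ) - 1) • (n : ZMod (4 * n)))), Edge.shift_shift]
      rw [sub_smul, one_smul, sub_add_cancel]
  refine Set.Subset.antisymm ?_ (Set.subset_preimage_image _ _)
  rintro e ⟨f, hf, hfe⟩
  obtain ⟨ℓ, rfl⟩ := cylEdge_eq_iff.1 hfe
  exact (hz ℓ f).2 hf

theorem image_wrap (hb : ∀ c ∈ S, cylLength c ≤ 2 * n) : cylEdge '' wrap S = S :=
  Set.image_preimage_eq_of_subset fun c hc => exists_cylEdge_eq (hb c hc)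

theorem CylTriangulation.cylLength_le (S : CylTriangulation n 2) : ∀ c ∈ S.1, cylLength c ≤ 2 * n :=
  fun _ hc => cylLength_le_of_crossingFree S.2.1 hc

theorem CylTriangulation.tri (S : CylTriangulation n 2) : Tri n (Rel (wrap S.1)) :=
  tri_of_maximal S.2

/-- The `2`-triangulations of the half-cylinder are the `n`-periodic `2`-triangulations of the
`4n`-gon. -/
noncomputable def wrapEquiv (n : ℕ) [NeZero n] :
    CylTriangulation n 2 ≃ PeriodicTriangulation (4 * n) n 2 where
  toFun S := ⟨wrap S.1, isPolyTriangulation_of_tri S.tri, shift_mem_wrap S.1⟩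
  invFun T := ⟨cylEdge '' T.1, maximal_of_tri
    (by rintro _ ⟨e, -, rfl⟩; exact cylLength_cylEdge_le e)
    (by rw [wrap_image T.2.2]; exact tri_of_isPolyTriangulation T.2.1 T.2.2)⟩
  left_inv S := Subtype.ext (image_wrap S.cylLength_le)
  right_inv T := Subtype.ext (wrap_image T.2.2)

theorem wrap_exchange (S : Set (CylEdge n)) (e f : Edge (ZMod (4 * n))) :
    wrap ((S \ {cylEdge e}) ∪ {cylEdge f}) =
      (wrap S \ e.orbit (n : ZMod (4 * n))) ∪ f.orbit (n : ZMod (4 * n)) := by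
  ext g
  simp only [wrap, Set.mem_preimage, Set.mem_union, Set.mem_sdiff, Set.mem_singleton_iff]
  rw [← cylEdge_eq_iff, ← cylEdge_eq_iff, @eq_comm _ (cylEdge e), @eq_comm _ (cylEdge f)]

theorem isPolyFlip_wrapEquiv_iff {S S' : CylTriangulation n 2} :
    IsPolyFlip (wrapEquiv n S) (wrapEquiv n S') ↔ IsCylFlip S S' := by
  constructor
  · rintro ⟨e, he, hlen, f, hf, h⟩
    refine ⟨cylEdge e, he, ⟨by rw [← polyLength_eq]; exact hlen, cylLength_cylEdge_le e⟩,
      cylEdge f, hf, ?_⟩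
    change wrap S'.1 = (wrap S.1 \ _) ∪ _ at h
    rw [← wrap_exchange] at h
    have h' : cylEdge '' wrap S'.1 = cylEdge '' wrap ((S.1 \ {cylEdge e}) ∪ {cylEdge f}) := by
      rw [h]
    rw [image_wrap S'.cylLength_le, image_wrap] at h'
    · exact h'
    · rintro c (hc | rfl)
      · exact S.cylLength_le c hc.1
      · exact cylLength_cylEdge_le f
  · rintro ⟨c, hc, hlen, d, hd, h⟩
    have hdl : cylLength d ≤ 2 * n := S'.cylLength_le d (by rw [h]; exact Or.inr rfl)
    obtain ⟨e, rfl⟩ := exists_cylEdge_eq hlen.2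
    obtain ⟨f, rfl⟩ := exists_cylEdge_eq hdl
    refine ⟨e, hc, by rw [polyLength_eq]; exact hlen.1, f, hd, ?_⟩
    change wrap S'.1 = (wrap S.1 \ _) ∪ _
    rw [h, wrap_exchange]

/-- The two flip graphs are isomorphic. -/
noncomputable def wrapIso (n : ℕ) [NeZero n] :
    cylFlipGraph n 2 ≃g periodicFlipGraph (4 * n) n 2 where
  toEquiv := wrapEquiv n
  map_rel_iff' {S S'} := by
    simp only [cylFlipGraph, periodicFlipGraph, SimpleGraph.fromRel_adj,
      isPolyFlip_wrapEquiv_iff, ne_eq, EmbeddingLike.apply_eq_iff_eq]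

theorem mem_wrapIso_iff (S : CylTriangulation n 2) (f : Edge (ZMod (4 * n))) :
    f ∈ (wrapIso n S).1 ↔
      ∃ e ∈ lift S.1, f.1 = e.1.map (fun i : ℤ => (i : ZMod (4 * n))) := by
  change cylEdge f ∈ S.1 ↔ _
  constructor
  · intro hf
    obtain ⟨E, hE⟩ := exists_isShortLift f
    exact ⟨E, by rw [hE.cylEdge_eq] at hf; exact hf, hE.2⟩
  · rintro ⟨E, hE, hf⟩
    have hs : IsShortLift n f E := ⟨S.cylLength_le _ hE, hf⟩
    rw [hs.cylEdge_eq]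
    exact hE

end Multitriangulation

/-! ### Flips of relevant edges and regularity -/

namespace Multitriangulation

variable {n : ℕ} [NeZero n] {S : Set (CylEdge n)}

/-- The relevant edges of a set of edges of the half-cylinder. -/
def relevant (S : Set (CylEdge n)) : Set (CylEdge n) := {c ∈ S | 2 < cylLength c}

theorem finite_of_cylLength_le (hb : ∀ c ∈ S, cylLength c ≤ 2 * n) : S.Finite := by
  have : NeZero (4 * n) := inferInstance
  have : Finite (Edge (ZMod (4 * n))) := inferInstanceAs (Finite {e : Sym2 (ZMod (4 * n)) // _})
  exact (Set.finite_range (cylEdge (n := n))).subset fun c hc => exists_cylEdge_eq (hb c hc)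

theorem Tri.ncard_relevant (h : Tri n (Rel (wrap S))) (hb : ∀ c ∈ S, cylLength c ≤ 2 * n) :
    (relevant S).ncard = 2 * (n - 1) := by
  have hn := NeZero.pos n
  have hcard := h.card_relevantEdges
  have hlab : ∀ α : ℤ × ℤ, ∃ c : CylEdge n, 0 < α.2 → ∃ E : Edge ℤ, E.1 = s(α.1, α.1 + α.2) ∧
      c = proj n E := by
    intro α
    by_cases hα : 0 < α.2
    · exact ⟨proj n ⟨s(α.1, α.1 + α.2), fun hd => hα.ne (by
        have : α.1 = α.1 + α.2 := hd
        omega)⟩, fun _ => ⟨_, rfl, rfl⟩⟩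
    · exact ⟨proj n ⟨s(0, 1), fun hd => absurd (show (0 : ℤ) = 1 from hd) (by norm_num)⟩,
        fun h => absurd h hα⟩
  choose F hF using hlab
  have himg : F '' (relevantEdges (n : ℤ) (Rel (wrap S)) : Set (ℤ × ℤ)) = relevant S := by
    ext c
    constructor
    · rintro ⟨α, hα, rfl⟩
      rw [Finset.mem_coe, mem_relevantEdges] at hα
      obtain ⟨E, hE, hc⟩ := hF α (by omega)
      rw [hc]
      refine ⟨?_, ?_⟩
      · have := (intRel_lift_iff (S := S) (by omega) (by omega)).2 hα.2
        exact (intRel_iff_mem hE).1 this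
      · rw [cylLength_proj, coverLength_eq hE]
        omega
    · rintro ⟨hc, hlen⟩
      have hlen' := hb c hc
      obtain ⟨E, rfl⟩ := Quotient.exists_rep c
      obtain ⟨u, v, huv, hE⟩ := int_exists_labels E
      change 2 < coverLength E at hlen
      change coverLength E ≤ 2 * n at hlen'
      rw [coverLength_eq hE] at hlen hlen'
      have h0 : 0 ≤ u % (n : ℤ) := Int.emod_nonneg _ (by omega)
      have h1 : u % (n : ℤ) < n := Int.emod_lt_of_pos _ (by omega)
      have h2 : IntRel (lift S) u v := ⟨E, hc, hE⟩
      rw [intRel_lift_iff huv (by omega)] at h2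
      have h3 := h.of_emod h2
      refine ⟨(u % n, v - u), ?_, ?_⟩
      · rw [Finset.mem_coe, mem_relevantEdges]
        refine ⟨by dsimp; omega, ?_⟩
        rwa [add_comm]
      · obtain ⟨E', hE', hc'⟩ := hF (u % n, v - u) (by dsimp; omega)
        rw [hc']
        refine proj_eq_iff.2 ⟨u / n, Subtype.ext ?_⟩
        rw [hE, Edge.shift_val _ hE']
        have := Int.emod_add_mul_ediv u n
        rw [Sym2.eq_iff]
        left
        constructor <;> simp <;> linarith
  have hinj : Set.InjOn F (relevantEdges (n : ℤ) (Rel (wrap S)) : Set (ℤ × ℤ)) := by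
    intro α hα β hβ hαβ
    rw [Finset.mem_coe, mem_relevantEdges] at hα hβ
    obtain ⟨E, hE, hc⟩ := hF α (by omega)
    obtain ⟨E', hE', hc'⟩ := hF β (by omega)
    rw [hc, hc', proj_eq_iff] at hαβ
    obtain ⟨ℓ, rfl⟩ := hαβ
    rw [Edge.shift_val _ hE, Sym2.eq_iff] at hE'
    simp only [smul_eq_mul] at hE'
    have hn' : (0 : ℤ) < n := by exact_mod_cast hn
    have h1 : β.1 = α.1 + ℓ * n ∧ β.2 = α.2 := by omega
    have h2 : -1 < ℓ := by
      refine lt_of_mul_lt hn' ?_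
      rw [neg_one_mul]
      omega
    have h3 : ℓ < 1 := by
      refine lt_of_mul_lt hn' ?_
      rw [one_mul]
      omega
    obtain rfl : ℓ = 0 := by omega
    exact Prod.ext (by linarith [h1.1]) h1.2.symm
  rw [← himg, hinj.ncard_image, Set.ncard_coe_finset]
  omega

theorem CylTriangulation.short_mem (S : CylTriangulation n 2) {c : CylEdge n}
    (hc : cylLength c ≤ 2) (hc' : cylLength c ≤ 2 * n) : c ∈ S.1 := by
  have hn := NeZero.pos n
  obtain ⟨E, rfl⟩ := Quotient.exists_rep c
  obtain ⟨u, v, huv, hE⟩ := int_exists_labels E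
  change coverLength E ≤ _ at hc hc'
  rw [coverLength_eq hE] at hc hc'
  have := S.tri.short huv (by omega) (by omega)
  exact (intRel_iff_mem hE).1 ((intRel_lift_iff huv (by omega)).2 this)

theorem CylTriangulation.lt_cylLength_of_notMem (S : CylTriangulation n 2) {c : CylEdge n}
    (hc : c ∉ S.1) (hc' : cylLength c ≤ 2 * n) : 2 < cylLength c := by
  by_contra h
  exact hc (S.short_mem (by omega) hc')

theorem exists_maximal_supset (hS : CrossingFree 3 (lift S)) : ∃ S' : CylTriangulation n 2,
    S ⊆ S'.1 := by
  have hfin : {S : Set (CylEdge n) | CrossingFree 3 (lift S)}.Finite := by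
    have : {c : CylEdge n | cylLength c ≤ 2 * n}.Finite := finite_of_cylLength_le fun c hc => hc
    exact this.finite_subsets.subset fun T hT c hc => cylLength_le_of_crossingFree hT hc
  obtain ⟨S', hS', hmax⟩ := hfin.exists_le_maximal (a := S) hS
  exact ⟨⟨S', hmax⟩, hS'⟩

/-- Exchanging a relevant edge yields a triangulation as soon as there is no `3`-crossing. -/
theorem CylTriangulation.maximal_exchange (S : CylTriangulation n 2) {c d : CylEdge n}
    (hc : c ∈ relevant S.1) (hd : d ∉ S.1) (hdl : cylLength d ≤ 2 * n)
    (hf : CrossingFree 3 (lift ((S.1 \ {c}) ∪ {d}))) :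
    Maximal (fun S : Set (CylEdge n) => CrossingFree 3 (lift S)) ((S.1 \ {c}) ∪ {d}) := by
  -- A triangulation containing the exchanged set has as many relevant edges as `S`, hence no
  -- further ones; the short edges are already present, so nothing is added.
  obtain ⟨S', hS'⟩ := exists_maximal_supset hf
  have hrel : 2 < cylLength d := S.lt_cylLength_of_notMem hd hdl
  have h1 : relevant ((S.1 \ {c}) ∪ {d}) = insert d (relevant S.1 \ {c}) := by
    ext x
    simp only [relevant, Set.mem_ofPred_eq, Set.mem_union, Set.mem_sdiff, Set.mem_singleton_iff,
      Set.mem_insert_iff]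
    constructor
    · rintro ⟨⟨h1, h2⟩ | h1, h3⟩
      · exact Or.inr ⟨⟨h1, h3⟩, h2⟩
      · exact Or.inl h1
    · rintro (rfl | ⟨⟨h1, h3⟩, h2⟩)
      · exact ⟨Or.inr rfl, hrel⟩
      · exact ⟨Or.inl ⟨h1, h2⟩, h3⟩
  have hfin : (relevant S.1).Finite :=
    (finite_of_cylLength_le S.cylLength_le).subset fun c hc => hc.1
  have hfin' : (relevant S'.1).Finite :=
    (finite_of_cylLength_le S'.cylLength_le).subset fun c hc => hc.1
  have h2 : (relevant ((S.1 \ {c}) ∪ {d})).ncard = (relevant S.1).ncard := by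
    rw [h1, Set.ncard_insert_of_notMem (fun h => hd h.1.1) hfin.sdiff,
      Set.ncard_sdiff_singleton_add_one hc hfin]
  have h3 : relevant ((S.1 \ {c}) ∪ {d}) = relevant S'.1 := by
    refine Set.eq_of_subset_of_ncard_le (fun x hx => ⟨hS' hx.1, hx.2⟩) ?_ hfin'
    rw [h2, S.tri.ncard_relevant S.cylLength_le, S'.tri.ncard_relevant S'.cylLength_le]
  have h4 : (S.1 \ {c}) ∪ {d} = S'.1 := by
    refine Set.Subset.antisymm hS' fun x hx => ?_
    by_cases hx2 : 2 < cylLength x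
    · have : x ∈ relevant S'.1 := ⟨hx, hx2⟩
      rw [← h3] at this
      exact this.1
    · refine Or.inl ⟨S.short_mem (by omega) (S'.cylLength_le x hx), ?_⟩
      rintro rfl
      exact hx2 hc.2
  rw [h4]
  exact S'.2

theorem rel_wrap_exchange_iff {e f : Edge (ZMod (4 * n))} {p r x y u v : ℤ}
    (he : e.1 = s((p : ZMod (4 * n)), (r : ZMod (4 * n))))
    (hf : f.1 = s((x : ZMod (4 * n)), (y : ZMod (4 * n)))) (huv : u < v) (hvu : v < u + 4 * n) :
    Rel (wrap ((S \ {cylEdge e}) ∪ {cylEdge f})) u v ↔ Exch n (Rel (wrap S)) p r x y u v := by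
  obtain ⟨g, hg⟩ := exists_edge (N := 4 * n) huv (by push_cast; exact hvu)
  rw [← cylEdge_mem_iff hg, Exch, ← cylEdge_mem_iff hg, ← cylEdge_eq_iff_orb he hg,
    ← cylEdge_eq_iff_orb hf hg]
  rfl

theorem crossingFree_exchange_iff (hb : ∀ c ∈ S, cylLength c ≤ 2 * n)
    {e f : Edge (ZMod (4 * n))} {p r x y : ℤ}
    (he : e.1 = s((p : ZMod (4 * n)), (r : ZMod (4 * n))))
    (hf : f.1 = s((x : ZMod (4 * n)), (y : ZMod (4 * n)))) :
    CrossingFree 3 (lift ((S \ {cylEdge e}) ∪ {cylEdge f})) ↔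
      Free (4 * n) (Exch n (Rel (wrap S)) p r x y) := by
  rw [crossingFree_lift_iff]
  · constructor <;> intro h a₁ a₂ a₃ b₁ b₂ b₃ ho h1 h2 h3
    · exact h a₁ a₂ a₃ b₁ b₂ b₃ ho ((rel_wrap_exchange_iff he hf (by omega) (by omega)).2 h1)
        ((rel_wrap_exchange_iff he hf (by omega) (by omega)).2 h2)
        ((rel_wrap_exchange_iff he hf (by omega) (by omega)).2 h3)
    · exact h a₁ a₂ a₃ b₁ b₂ b₃ ho ((rel_wrap_exchange_iff he hf (by omega) (by omega)).1 h1)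
        ((rel_wrap_exchange_iff he hf (by omega) (by omega)).1 h2)
        ((rel_wrap_exchange_iff he hf (by omega) (by omega)).1 h3)
  · rintro c (hc | rfl)
    · exact hb c hc.1
    · exact cylLength_cylEdge_le f

/-- Every relevant edge of a triangulation of the half-cylinder can be flipped in one way. -/
theorem CylTriangulation.exists_unique_flip (S : CylTriangulation n 2) {c : CylEdge n}
    (hc : c ∈ relevant S.1) :
    ∃! S' : CylTriangulation n 2, ∃ d ∉ S.1, S'.1 = (S.1 \ {c}) ∪ {d} := by
  have hn := NeZero.pos n
  obtain ⟨e, rfl⟩ := exists_cylEdge_eq (S.cylLength_le c hc.1)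
  obtain ⟨E, hE⟩ := exists_isShortLift e
  have hlen := hc.2
  rw [hE.cylEdge_eq, cylLength_proj] at hlen
  obtain ⟨p, r, hpr, hE'⟩ := int_exists_labels E
  rw [isShortLift_iff hE'] at hE
  rw [coverLength_eq hE'] at hlen
  have hmem := hc.1
  rw [cylEdge_mem_iff hE.2] at hmem
  obtain ⟨a, m, ham, hno, hf, huniq⟩ :=
    S.tri.exists_unique_exchange (by omega) (by omega) hmem
  obtain ⟨f, hfe⟩ := exists_edge (N := 4 * n) ham.1 (by push_cast; exact ham.2)
  have hfS : cylEdge f ∉ S.1 := fun h => hno ((cylEdge_mem_iff hfe).1 h)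
  have hmax := S.maximal_exchange hc hfS (cylLength_cylEdge_le f)
    ((crossingFree_exchange_iff S.cylLength_le hE.2 hfe).2 hf)
  refine ⟨⟨_, hmax⟩, ⟨_, hfS, rfl⟩, ?_⟩
  rintro S' ⟨d, hd, hS'⟩
  obtain ⟨g, rfl⟩ := exists_cylEdge_eq (S'.cylLength_le d (by rw [hS']; exact Or.inr rfl))
  obtain ⟨x, y, hxy, hyx, hg⟩ := exists_labels g
  have hcf : CrossingFree 3 (lift S'.1) := S'.2.1
  rw [hS', crossingFree_exchange_iff S.cylLength_le hE.2 hg] at hcf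
  have := huniq x y hxy (by push_cast at hyx; exact hyx)
    (fun h => hd ((cylEdge_mem_iff hg).2 h)) hcf
  rw [← cylEdge_eq_iff_orb hfe hg] at this
  exact Subtype.ext (by rw [hS', this])

/-- The inserted edge is itself relevant, because a triangulation misses no short edge. Thus the
symmetrization in `cylFlipGraph` adds no neighbours. -/
theorem IsCylFlip.symm {S S' : CylTriangulation n 2} (h : IsCylFlip S S') : IsCylFlip S' S := by
  obtain ⟨c, hc, hlen, d, hd, h⟩ := h
  have hdS' : d ∈ S'.1 := by rw [h]; exact Or.inr rfl
  have hdl := S'.cylLength_le d hdS'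
  have hcd : c ≠ d := by rintro rfl; exact hd hc
  refine ⟨d, hdS', ⟨S.lt_cylLength_of_notMem hd hdl, hdl⟩, c, ?_, ?_⟩
  · rw [h]
    rintro (h1 | h1)
    · exact h1.2 rfl
    · exact hcd h1
  · rw [h]
    ext x
    simp only [Set.mem_union, Set.mem_sdiff, Set.mem_singleton_iff]
    constructor
    · intro hx
      by_cases hxc : x = c
      · exact Or.inr hxc
      · exact Or.inl ⟨Or.inl ⟨hx, hxc⟩, by rintro rfl; exact hd hx⟩
    · rintro (⟨⟨h1, -⟩ | h1, h2⟩ | rfl)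
      · exact h1
      · exact absurd h1 h2
      · exact hc

theorem neighborSet_cylFlipGraph (S : CylTriangulation n 2) :
    ((cylFlipGraph n 2).neighborSet S).Finite ∧
      ((cylFlipGraph n 2).neighborSet S).ncard = 2 * (n - 1) := by
  have hex : ∀ c, ∃ S' : CylTriangulation n 2, c ∈ relevant S.1 →
      (∃ d ∉ S.1, S'.1 = (S.1 \ {c}) ∪ {d}) ∧
      ∀ S'' : CylTriangulation n 2, (∃ d ∉ S.1, S''.1 = (S.1 \ {c}) ∪ {d}) → S'' = S' := by
    intro c
    by_cases hc : c ∈ relevant S.1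
    · obtain ⟨S', h1, h2⟩ := S.exists_unique_flip hc
      exact ⟨S', fun _ => ⟨h1, h2⟩⟩
    · exact ⟨S, fun h => absurd h hc⟩
  choose g hg using hex
  have hnot : ∀ c ∈ relevant S.1, c ∉ (g c).1 := by
    intro c hc
    obtain ⟨⟨d, hd, h⟩, -⟩ := hg c hc
    rw [h]
    rintro (h1 | h1)
    · exact h1.2 rfl
    · exact hd (h1 ▸ hc.1)
  have himg : (cylFlipGraph n 2).neighborSet S = g '' relevant S.1 := by
    ext S'
    rw [SimpleGraph.mem_neighborSet, cylFlipGraph, SimpleGraph.fromRel_adj]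
    constructor
    · rintro ⟨-, h⟩
      obtain ⟨c, hc, hlen, d, hd, h'⟩ := h.elim id IsCylFlip.symm
      exact ⟨c, ⟨hc, hlen.1⟩, ((hg c ⟨hc, hlen.1⟩).2 S' ⟨d, hd, h'⟩).symm⟩
    · rintro ⟨c, hc, rfl⟩
      obtain ⟨d, hd, h⟩ := (hg c hc).1
      refine ⟨fun he => hnot c hc (he ▸ hc.1), Or.inl ⟨c, hc.1, ⟨hc.2, S.cylLength_le c hc.1⟩, d,
        hd, h⟩⟩
  -- Flipping `c` removes `c`, whereas flipping any other edge keeps it.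
  have hinj : Set.InjOn g (relevant S.1) := by
    intro c hc c' hc' he
    by_contra hne
    refine hnot c hc ?_
    obtain ⟨d, hd, h⟩ := (hg c' hc').1
    rw [he, h]
    exact Or.inl ⟨hc.1, hne⟩
  rw [himg, hinj.ncard_image]
  exact ⟨((finite_of_cylLength_le S.cylLength_le).subset fun c hc => hc.1).image g,
    S.tri.ncard_relevant S.cylLength_le⟩

end Multitriangulation

theorem SimpleGraph.exists_isRegularOfDegree {V : Type*} {G : SimpleGraph V} {d : ℕ}
    (h : ∀ v, (G.neighborSet v).Finite ∧ (G.neighborSet v).ncard = d) :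
    ∃ _ : G.LocallyFinite, G.IsRegularOfDegree d := by
  refine ⟨fun v => (h v).1.fintype, fun v => ?_⟩
  let _ := (h v).1.fintype
  refine Eq.trans ?_ (h v).2
  rw [← Nat.card_coe_set_eq, Nat.card_eq_fintype_card]
  exact (@SimpleGraph.card_neighborSet_eq_degree _ G v (h v).1.fintype).symm

theorem SimpleGraph.Iso.neighborSet_eq_image {V W : Type*} {G : SimpleGraph V} {H : SimpleGraph W}
    (φ : G ≃g H) (w : W) : H.neighborSet w = φ '' G.neighborSet (φ.symm w) := by
  ext x
  constructor
  · intro hx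
    exact ⟨φ.symm x, φ.symm.map_adj_iff.2 hx, φ.apply_symm_apply x⟩
  · rintro ⟨y, hy, rfl⟩
    have := φ.map_adj_iff.2 hy
    rwa [φ.apply_symm_apply] at this

theorem mainTheorem2 (n : ℕ) (hn : 1 ≤ n) :
    (∃ _ : (Multitriangulation.periodicFlipGraph (4 * n) n 2).LocallyFinite,
      (Multitriangulation.periodicFlipGraph (4 * n) n 2).IsRegularOfDegree (2 * (n - 1))) ∧
    (∃ _ : (Multitriangulation.cylFlipGraph n 2).LocallyFinite,
      (Multitriangulation.cylFlipGraph n 2).IsRegularOfDegree (2 * (n - 1))) ∧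
    (∃ Φ : Multitriangulation.cylFlipGraph n 2 ≃g Multitriangulation.periodicFlipGraph (4 * n) n 2,
      ∀ (T : Multitriangulation.CylTriangulation n 2)
        (f : Multitriangulation.Edge (ZMod (4 * n))),
        f ∈ (Φ T).1 ↔ ∃ e ∈ Multitriangulation.lift T.1,
          f.1 = e.1.map (fun i : ℤ => (i : ZMod (4 * n)))) := by
  have : NeZero n := ⟨by omega⟩
  refine ⟨SimpleGraph.exists_isRegularOfDegree fun T => ?_,
    SimpleGraph.exists_isRegularOfDegree Multitriangulation.neighborSet_cylFlipGraph,
    Multitriangulation.wrapIso n, Multitriangulation.mem_wrapIso_iff⟩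
  obtain ⟨h1, h2⟩ :=
    Multitriangulation.neighborSet_cylFlipGraph ((Multitriangulation.wrapIso n).symm T)
  rw [(Multitriangulation.wrapIso n).neighborSet_eq_image T,
    Set.ncard_image_of_injective _ (Multitriangulation.wrapIso n).injective]
  exact ⟨h1.image _, h2⟩
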